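/- **Setting.** Let $n\ge 2$, $p>\lfloor n/2\rfloor$, $a>0$, let $\Omega\subseteq\mathbb R^n$ be a bounded domain, and let $\varphi$ be a positive convex function on $(0,\infty)$ with $\lim_{t\to0^+}\varphi(t)=\infty$ and $\lim_{t\to\infty}\varphi(t)/t=\infty$, extended by $\varphi(t)=\infty$ for $t\le 0$. For $f\in W^{1,p}(\Omega,\mathbb R^n)$ put $$E(f)=\int_\Omega\bigl(|Df|^p+\varphi(J_f)\bigr)\,dx,\qquad J_f=\det Df .$$ A map $f$ satisfies the Lusin $(N)$ condition if $|f(S)|=0$ for every $S\subseteq\Omega$ with $|S|=0$. Let $f_0\in W^{1,p}(\Omega,\mathbb R^n)$ be a homeomorphism from $\overline\Omega$ onto its image in $\mathbb R^n$ that satisfies the Lusin $(N)$ condition, with $E(f_0)<\infty$ and $|f_0(\partial\Omega)|=0$. Let $\mathcal K$ be the family of connected compact sets $K\subseteq f_0(\Omega)$ with $|K|>0$ and $\mathcal H^{n-1}(\partial K)<\infty$. Let $\mathcal H_{c,f_0}^{1,p}$ be the class of all $f\in W^{1,p}(\Omega,\mathbb R^n)$ that satisfy the Lusin $(N)$ condition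 and $f=f_0$ on $\partial\Omega$, and for which there are finitely many points $x_1,\dots,x_m\in\Omega$ and pairwise disjoint $K_1,\dots,K_m\in\mathcal K$ ($m\ge 0$) such that $f$ is a homeomorphism of $\overline\Omega\setminus\{x_1,\dots,x_m\}$ onto $\overline{f_0(\Omega)}\setminus(K_1\cup\dots\cup K_m)$. For such $f$ the cavity set is $A(f)=K_1\cup\dots\cup K_m$, and $E_c(f)=E(f)+a\,P(A(f),\mathbb R^n)$, where $P$ denotes the perimeter. For measurable sets, $A_k\to A$ means $|A_k\triangle A|\to0$. Let $C\in\mathbb R$. **Theorem 4.2.** (i) Let $f_k\in\mathcal H_{c,f_0}^{1,p}$ satisfy $E_c(f_k)\le C$ for all $k$, $f_k\rightharpoonup f$ weakly in $W^{1,p}(\Omega,\mathbb R^n)$ and $f_k\to f$ a.e. in $\Omega$. If two subsequences satisfy $A(f_{k_\ell})\to A^1$ and $A(f_{k_m})\to A^2$, where $A^1,A^2$ are measurable, then $|A^1\triangle A^2|=0$. (ii) Consequently the cavity set of a limit map is well defined: if $f$ is the weak limit in $W^{1,p}(\Omega,\mathbb R^n)$ of some sequence in $\mathcal H_{c,f_0}^{1,p}$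 with $E_c\le C$, then there is a measurable set $A(f)$, unique up to a null set, such that $A(f_k)\to A(f)$ for every sequence $f_k\in\mathcal H_{c,f_0}^{1,p}$ with $E_c(f_k)\le C$ and $f_k\rightharpoonup f$ weakly in $W^{1,p}(\Omega,\mathbb R^n)$. -/

import Mathlib

open MeasureTheory Filter Topology Set
open scoped ENNReal ContDiff symmDiff

namespace Cavitation

noncomputable section

/-- Euclidean `n`-space. -/
abbrev Space (n : ℕ) := EuclideanSpace ℝ (Fin n)

/-! ### Sobolev maps -/

/-- `G` is the weak derivative of the locally integrable map `f` in the open set `Ω`: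
for every scalar test function `ψ ∈ C_c^∞(Ω)` and every direction `v`,
`∫_Ω (∂_v ψ) f = - ∫_Ω ψ (G v)`. -/
structure HasWeakDeriv {n : ℕ} (Ω : Set (Space n)) (f : Space n → Space n)
    (G : Space n → (Space n →L[ℝ] Space n)) : Prop where
  locInt : LocallyIntegrableOn f Ω volume
  locInt_deriv : LocallyIntegrableOn G Ω volume
  integral_eq : ∀ ψ : Space n → ℝ, ContDiff ℝ ∞ ψ → HasCompactSupport ψ → tsupport ψ ⊆ Ω →
    ∀ v : Space n, ∫ x in Ω, (fderiv ℝ ψ x v) • f x = - ∫ x in Ω, ψ x • G x v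

open Classical in
/-- The weak derivative `Df` of `f` in `Ω` (unique up to null sets; `0` if there is none). -/
def weakDeriv {n : ℕ} (Ω : Set (Space n)) (f : Space n → Space n) :
    Space n → (Space n →L[ℝ] Space n) :=
  if h : ∃ G, HasWeakDeriv Ω f G then h.choose else 0

/-- `f ∈ W^{1,p}(Ω, ℝⁿ)`: `f ∈ L^p(Ω)`, and `f` has a weak derivative in `L^p(Ω)`. -/
def MemSobolev {n : ℕ} (Ω : Set (Space n)) (p : ℝ) (f : Space n → Space n) : Prop :=
  MemLp f (ENNReal.ofReal p) (volume.restrict Ω) ∧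
    ∃ G, HasWeakDeriv Ω f G ∧ MemLp G (ENNReal.ofReal p) (volume.restrict Ω)

/-- `f_k ⇀ f` weakly in `W^{1,p}(Ω, ℝⁿ)`, where `1 < p < ∞`: all maps lie in `W^{1,p}`, and
`f_k ⇀ f`, `Df_k ⇀ Df` weakly in `L^p(Ω)`, i.e. when tested with the functions of `L^q(Ω)`,
`1/p + 1/q = 1` (the integrals are vector- and matrix-valued, so this is componentwise weak
convergence). -/
structure WeakConv {n : ℕ} (Ω : Set (Space n)) (p : ℝ) (fk : ℕ → Space n → Space n)
    (f : Space n → Space n) : Prop where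
  mem : ∀ k, MemSobolev Ω p (fk k)
  mem_lim : MemSobolev Ω p f
  tendsto : ∀ q : ℝ, p.HolderConjugate q → ∀ g : Space n → ℝ,
    MemLp g (ENNReal.ofReal q) (volume.restrict Ω) →
      Tendsto (fun k => ∫ x in Ω, g x • fk k x) atTop (𝓝 (∫ x in Ω, g x • f x))
  tendsto_deriv : ∀ q : ℝ, p.HolderConjugate q → ∀ g : Space n → ℝ,
    MemLp g (ENNReal.ofReal q) (volume.restrict Ω) →
      Tendsto (fun k => ∫ x in Ω, g x • weakDeriv Ω (fk k) x) atTop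
        (𝓝 (∫ x in Ω, g x • weakDeriv Ω f x))

/-! ### Energies -/

/-- The growth assumptions on `φ`: it is positive and convex on `(0, ∞)`, tends to `∞` at `0⁺`,
and is superlinear at `∞`. -/
structure GrowthAssumptions (φ : ℝ → ℝ) : Prop where
  pos : ∀ t, 0 < t → 0 < φ t
  convex : ConvexOn ℝ (Ioi 0) φ
  tendsto_zero : Tendsto φ (𝓝[>] 0) atTop
  tendsto_top : Tendsto (fun t => φ t / t) atTop atTop

/-- `φ` is given on `(0, ∞)` and is extended by `∞` to `(-∞, 0]`. -/
def extend (φ : ℝ → ℝ) (t : ℝ) : ℝ≥0∞ := if 0 < t then ENNReal.ofReal (φ t) else ⊤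

/-- The energy `E(f) = ∫_Ω |Df|^p + φ(J_f)`, with values in `[0, ∞]`, where `J_f = det Df`. -/
def energy {n : ℕ} (Ω : Set (Space n)) (p : ℝ) (φ : ℝ → ℝ) (f : Space n → Space n) : ℝ≥0∞ :=
  ∫⁻ x in Ω, (‖weakDeriv Ω f x‖ₑ ^ p + extend φ (weakDeriv Ω f x).det)

/-- The divergence of a vector field. -/
def divergence {n : ℕ} (ψ : Space n → Space n) (x : Space n) : ℝ :=
  ∑ i, fderiv ℝ ψ x (EuclideanSpace.single i 1) i

/-- The perimeter of `A` in `ℝⁿ`: the supremum of `∫_A div ψ` over the `C¹` vector fields `ψ` of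
compact support with `|ψ| ≤ 1`. -/
def perimeter {n : ℕ} (A : Set (Space n)) : ℝ≥0∞ :=
  ⨆ (ψ : Space n → Space n) (_ : ContDiff ℝ 1 ψ) (_ : HasCompactSupport ψ)
    (_ : ∀ x, ‖ψ x‖ ≤ 1), ENNReal.ofReal (∫ x in A, divergence ψ x)

/-- The energy `E_c(f) = E(f) + a P(A(f), ℝⁿ)` of a map `f` with cavity set `A(f) = A`. -/
def cavityEnergy {n : ℕ} (Ω : Set (Space n)) (p : ℝ) (φ : ℝ → ℝ) (a : ℝ)
    (f : Space n → Space n) (A : Set (Space n)) : ℝ≥0∞ :=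
  energy Ω p φ f + ENNReal.ofReal a * perimeter A

/-! ### Homeomorphisms with finitely many cavities -/

/-- The Lusin `(N)` condition on `Ω`. -/
def LusinN {n : ℕ} (Ω : Set (Space n)) (f : Space n → Space n) : Prop :=
  ∀ S ⊆ Ω, volume S = 0 → volume (f '' S) = 0

/-- `𝒦(U)`: the connected compact subsets of `U` of positive measure whose boundary has finite
`(n-1)`-dimensional Hausdorff measure. -/
def admissibleCavities {n : ℕ} (U : Set (Space n)) : Set (Set (Space n)) :=
  {K | K ⊆ U ∧ IsConnected K ∧ IsCompact K ∧ 0 < volume K ∧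
    Measure.hausdorffMeasure ((n : ℝ) - 1) (frontier K) < ⊤}

/-- `f` belongs to `𝓗_{c,f₀}^{1,p}` and `A(f) = A`: there are points `x₁, …, x_m ∈ Ω` and disjoint
`K₁, …, K_m ∈ 𝒦(f₀(Ω))` such that `f` is a homeomorphism of `Ω̄ ∖ {x₁, …, x_m}` onto
`\overline{f₀(Ω)} ∖ (K₁ ∪ … ∪ K_m)`, and `A = K₁ ∪ … ∪ K_m`; moreover `f ∈ W^{1,p}(Ω, ℝⁿ)`,
`f = f₀` on `∂Ω`, and `f` satisfies the Lusin `(N)` condition. -/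
structure HasCavitySet {n : ℕ} (Ω : Set (Space n)) (p : ℝ) (f₀ f : Space n → Space n)
    (A : Set (Space n)) : Prop where
  mem_sobolev : MemSobolev Ω p f
  exists_cavities : ∃ (m : ℕ) (x : Fin m → Space n) (K : Fin m → Set (Space n)),
    (∀ i, x i ∈ Ω) ∧ (∀ i, K i ∈ admissibleCavities (f₀ '' Ω)) ∧
    Pairwise (fun i j => Disjoint (K i) (K j)) ∧
    IsEmbedding ((closure Ω \ range x).domRestrict f) ∧
    f '' (closure Ω \ range x) = closure (f₀ '' Ω) \ ⋃ i, K i ∧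
    A = ⋃ i, K i
  eqOn_frontier : EqOn f f₀ (frontier Ω)
  lusin : LusinN Ω f

/-- `f_k ∈ 𝓗_{c,f₀}^{1,p}` with cavity sets `A(f_k) = A_k`, `E_c(f_k) ≤ C` for all `k`, and
`f_k ⇀ f` weakly in `W^{1,p}(Ω, ℝⁿ)`. -/
structure IsApproximation {n : ℕ} (Ω : Set (Space n)) (p : ℝ) (φ : ℝ → ℝ) (a : ℝ)
    (f₀ : Space n → Space n) (C : ℝ) (fk : ℕ → Space n → Space n) (Ak : ℕ → Set (Space n))
    (f : Space n → Space n) : Prop where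
  hasCavitySet : ∀ k, HasCavitySet Ω p f₀ (fk k) (Ak k)
  energy_le : ∀ k, cavityEnergy Ω p φ a (fk k) (Ak k) ≤ ENNReal.ofReal C
  weakConv : WeakConv Ω p fk f

/-- The class of weak limits of sequences of `𝓗_{c,f₀}^{1,p}` with `E_c ≤ C`. -/
def weakClosure {n : ℕ} (Ω : Set (Space n)) (p : ℝ) (φ : ℝ → ℝ) (a : ℝ)
    (f₀ : Space n → Space n) (C : ℝ) : Set (Space n → Space n) :=
  {f | ∃ fk Ak, IsApproximation Ω p φ a f₀ C fk Ak f}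

/-- Convergence of sets in measure: `|A_k △ A| → 0`. -/
def TendstoInMeas {n : ℕ} (Ak : ℕ → Set (Space n)) (A : Set (Space n)) : Prop :=
  Tendsto (fun k => volume (Ak k ∆ A)) atTop (𝓝 0)

/-- `A` is a cavity set `A(f)` of the limit map `f`: it is the limit in measure of the cavity sets
`A(f_k)` for every sequence `f_k` in `𝓗_{c,f₀}^{1,p}` with `E_c(f_k) ≤ C` and `f_k ⇀ f`. -/
def IsLimitCavitySet {n : ℕ} (Ω : Set (Space n)) (p : ℝ) (φ : ℝ → ℝ) (a : ℝ)
    (f₀ : Space n → Space n) (C : ℝ) (f : Space n → Space n) (A : Set (Space n)) : Prop :=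
  NullMeasurableSet A volume ∧
    ∀ fk Ak, IsApproximation Ω p φ a f₀ C fk Ak f → TendstoInMeas Ak A

end

end Cavitation

open Cavitation

/-! The limit map `f` alone determines which sets are null for Lebesgue measure on `D \ A`, where `D
= closure (f₀ '' Ω)` and `A` is a limit of the cavity sets; this fixes `A` up to a null set.

Finite energy forces `J_k = det Df_k > 0` a.e., and the change of variables formula
(`HasCavitySet.lintegral_abs_det_eq`) says that `f_k` transports the measure `J_k dx` to Lebesgue
measure on `D \ A_k`. Suppose that `f_k → f` a.e. and `A_k → B` in measure. The blow-up of `φ` at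
`0` prevents `J_k` from being small on sets of non-negligible measure, so a set that is null for
volume on `D \ B` has a null preimage under `f` (`TransportLimit.measure_preimage_eq_zero`). The
superlinearity of `φ` makes the `J_k` equi-integrable, which gives the converse
(`TransportLimit.volume_inter_eq_zero`). For two limits `B`, `B'`, volume on `D \ B` and on `D \ B'`
thus have the same null sets, whence `B = B'` a.e. (`TransportLimit.volume_sdiff_eq_zero`). This is
part (i).

Part (ii) adds compactness. Bounded energy and weak convergence give convergence in measure
(`WeakConv.tendstoInMeasure`), hence a.e. along a subsequence; bounded perimeter gives a further
subsequence whose cavity sets converge (`exists_subseq_tendstoInMeas`). All such limits agree by the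
argument above, so full sequences converge.

Dyadic mollification supplies the analytic tools. Its error is controlled by averages of the
derivative. At Lebesgue points this makes a Sobolev map differentiable along countably many sets
filling `Ω` up to a null set (`HasWeakDeriv.exists_hasFDerivWithinAt`), and with Lusin `(N)` the
classical area formula carries over. In integrated form the same bound gives the Rellich-type
compactness; a separate duality estimate gives the analogue for indicators of sets of finite
perimeter. -/

namespace Cavitation

open scoped Convolution

/-! ### Dyadic mollification -/

section Mollify

variable {n : ℕ} {E : Type*} [NormedAddCommGroup E] [NormedSpace ℝ E]

/-- The smooth bump function on the ball of radius `2^{-j}`. -/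
noncomputable def dyadicBump (n j : ℕ) : ContDiffBump (0 : Space n) where
  rIn := (1 / 2) ^ j / 2
  rOut := (1 / 2) ^ j
  rIn_pos := by positivity
  rIn_lt_rOut := half_lt_self (by positivity)

/-- The standard mollifier at scale `2^{-j}`. -/
noncomputable def mollifier (n j : ℕ) : Space n → ℝ := (dyadicBump n j).normed volume

/-- The mollification of `g` at scale `2^{-j}`. -/
noncomputable def mollify (j : ℕ) (g : Space n → E) : Space n → E :=
  mollifier n j ⋆[ContinuousLinearMap.lsmul ℝ ℝ, volume] g

lemma mollifier_contDiff (j : ℕ) : ContDiff ℝ ∞ (mollifier n j) :=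
  (dyadicBump n j).contDiff_normed

lemma mollifier_continuous (j : ℕ) : Continuous (mollifier n j) :=
  (dyadicBump n j).continuous_normed

lemma mollifier_hasCompactSupport (j : ℕ) : HasCompactSupport (mollifier n j) :=
  (dyadicBump n j).hasCompactSupport_normed

lemma mollifier_nonneg (j : ℕ) (x : Space n) : 0 ≤ mollifier n j x :=
  (dyadicBump n j).nonneg_normed x

lemma integral_mollifier (j : ℕ) : ∫ x, mollifier n j x = 1 :=
  (dyadicBump n j).integral_normed

lemma mollifier_integrable (j : ℕ) : Integrable (mollifier n j) :=
  (dyadicBump n j).integrable_normed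

lemma support_mollifier (j : ℕ) :
    Function.support (mollifier n j) = Metric.ball 0 ((1 / 2) ^ j) :=
  (dyadicBump n j).support_normed_eq

lemma mollifier_neg (j : ℕ) (x : Space n) : mollifier n j (-x) = mollifier n j x :=
  (dyadicBump n j).normed_neg x

/-- A uniform bound for the mollifier at scale `2^{-j}`. -/
noncomputable def mollifierBound (n j : ℕ) : ℝ :=
  1 / volume.real (Metric.closedBall (0 : Space n) ((1 / 2) ^ j / 2))

lemma mollifier_le (j : ℕ) (x : Space n) : mollifier n j x ≤ mollifierBound n j :=
  (dyadicBump n j).normed_le_div_measure_closedBall_rIn volume x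

lemma volume_real_closedBall_pos (x : Space n) {r : ℝ} (hr : 0 < r) :
    0 < volume.real (Metric.closedBall x r) :=
  ENNReal.toReal_pos (Metric.measure_closedBall_pos volume x hr).ne'
    measure_closedBall_lt_top.ne

lemma mollifierBound_pos (j : ℕ) : 0 < mollifierBound n j :=
  one_div_pos.2 (volume_real_closedBall_pos _ (by positivity))

lemma mollifierBound_le_succ (j : ℕ) : mollifierBound n j ≤ mollifierBound n (j + 1) := by
  refine one_div_le_one_div_of_le (volume_real_closedBall_pos _ (by positivity)) ?_
  refine measureReal_mono (Metric.closedBall_subset_closedBall ?_) measure_closedBall_lt_top.ne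
  have : (0 : ℝ) < (1 / 2) ^ j := by positivity
  rw [pow_succ]; linarith

lemma mollify_apply (j : ℕ) (g : Space n → E) (x : Space n) :
    mollify j g x = ∫ t, mollifier n j (x - t) • g t :=
  convolution_lsmul_swap

lemma mollifier_sub_hasCompactSupport (j : ℕ) (x : Space n) :
    HasCompactSupport fun t => mollifier n j (x - t) :=
  (mollifier_hasCompactSupport j).comp_homeomorph (Homeomorph.subLeft x)

lemma mollifier_sub_integrable_smul (j : ℕ) {g : Space n → E} (hg : LocallyIntegrable g)
    (x : Space n) : Integrable fun t => mollifier n j (x - t) • g t :=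
  hg.integrable_smul_left_of_hasCompactSupport
    ((mollifier_continuous j).comp (continuous_const.sub continuous_id))
    (mollifier_sub_hasCompactSupport j x)

lemma integral_mollifier_sub (j : ℕ) (x : Space n) : ∫ t, mollifier n j (x - t) = 1 := by
  rw [integral_sub_left_eq_self (mollifier n j)]; exact integral_mollifier j

lemma mollify_continuous (j : ℕ) {g : Space n → E} (hg : LocallyIntegrable g) :
    Continuous (mollify j g) :=
  (mollifier_hasCompactSupport j).continuous_convolution_left _ (mollifier_continuous j) hg

lemma mollify_sub_eq (j : ℕ) [CompleteSpace E] {g : Space n → E} (hg : LocallyIntegrable g)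
    (x : Space n) (c : E) :
    mollify j g x - c = ∫ t, mollifier n j (x - t) • (g t - c) := by
  simp_rw [smul_sub]
  rw [integral_sub (mollifier_sub_integrable_smul j hg x)
    (mollifier_sub_integrable_smul j (locallyIntegrable_const c) x), integral_smul_const,
    integral_mollifier_sub, one_smul, mollify_apply]

/-- The kernel centred at `y` has mass one and lives in the larger ball around `x`. One average
around `x` thus serves for all nearby `y`. -/
lemma norm_mollify_sub_le (j : ℕ) [CompleteSpace E] {g : Space n → E}
    (hg : LocallyIntegrable g) {x y : Space n} {R : ℝ} (hR : dist y x + (1 / 2) ^ j ≤ R) (c : E) :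
    ‖mollify j g y - c‖ ≤ mollifierBound n j * ∫ t in Metric.closedBall x R, ‖g t - c‖ := by
  rw [mollify_sub_eq j hg, ← integral_const_mul,
    ← integral_indicator Metric.isClosed_closedBall.measurableSet]
  have hi : IntegrableOn (fun t => ‖g t - c‖) (Metric.closedBall x R) :=
    (((hg.sub (locallyIntegrable_const c)).integrableOn_isCompact
      (isCompact_closedBall x R))).norm
  refine norm_integral_le_of_norm_le
    (IntegrableOn.integrable_indicator (hi.const_mul _) Metric.isClosed_closedBall.measurableSet) ?_
  refine Eventually.of_forall fun t => ?_
  rw [norm_smul, Real.norm_of_nonneg (mollifier_nonneg _ _)]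
  by_cases ht : t ∈ Metric.closedBall x R
  · rw [indicator_of_mem ht]
    gcongr
    exact mollifier_le _ _
  · have : mollifier n j (y - t) = 0 := by
      rw [← Function.notMem_support, support_mollifier, Metric.mem_ball, dist_zero_right,
        ← dist_eq_norm]
      intro h
      refine ht (Metric.mem_closedBall.2 ?_)
      have := dist_triangle t y x
      rw [dist_comm t y] at this
      linarith
    rw [this, zero_mul, indicator_of_notMem ht]

lemma ae_tendsto_mollify [CompleteSpace E] {g : Space n → E} (hg : LocallyIntegrable g) :
    ∀ᵐ x, Tendsto (fun j => mollify j g x) atTop (𝓝 (g x)) := by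
  refine ContDiffBump.ae_convolution_tendsto_right_of_locallyIntegrable (φ := dyadicBump n)
    (K := 2) ?_ (Eventually.of_forall fun j => ?_) hg
  · exact tendsto_pow_atTop_nhds_zero_of_lt_one (by norm_num) (by norm_num)
  · simp [dyadicBump]; linarith

/-- Both sides are the convolution of `g` with the product kernel, by associativity and
commutativity of convolution. -/
lemma mollify_comm [CompleteSpace E] (i j : ℕ) {g : Space n → E} (hg : LocallyIntegrable g) :
    mollify i (mollify j g) = mollify j (mollify i g) := by
  have hgn : LocallyIntegrable fun x => ‖g x‖ := fun x => (hg x).norm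
  have key : ∀ i j x, mollify i (mollify j g) x = mollify (E := E) j (mollify i g) x := by
    intro i j x
    have h : ∀ i j, (mollifier n i ⋆[ContinuousLinearMap.lsmul ℝ ℝ, volume] mollifier n j)
        ⋆[ContinuousLinearMap.lsmul ℝ ℝ, volume] g = mollify i (mollify j g) := by
      intro i j
      ext x
      refine convolution_assoc _ _ _ _ ?_ (mollifier_continuous i).aestronglyMeasurable
        (mollifier_continuous j).aestronglyMeasurable hg.aestronglyMeasurable ?_ ?_ ?_
      · intro a b c
        simp [mul_smul, smul_comm a b c]
      · refine Eventually.of_forall fun y => ?_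
        exact (mollifier_hasCompactSupport i).convolutionExists_left _ (mollifier_continuous i)
          (mollifier_continuous j).locallyIntegrable y
      · refine Eventually.of_forall fun y => ?_
        have := (mollifier_hasCompactSupport j).convolutionExists_left
          (ContinuousLinearMap.mul ℝ ℝ) (mollifier_continuous j) hgn y
        refine this.congr ?_
        refine Eventually.of_forall fun t => ?_
        simp [Real.norm_of_nonneg (mollifier_nonneg j t)]
      · have hc : Continuous ((fun x => ‖mollifier n j x‖) ⋆[ContinuousLinearMap.mul ℝ ℝ, volume]
            fun x => ‖g x‖) :=
          (mollifier_hasCompactSupport j).norm.continuous_convolution_left _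
            (mollifier_continuous j).norm hgn
        have := (mollifier_hasCompactSupport i).norm.convolutionExists_left
          (ContinuousLinearMap.mul ℝ ℝ) (mollifier_continuous i).norm (hc.locallyIntegrable (μ := volume)) x
        exact this
    rw [← h i j, ← h j i]
    congr 1
    rw [← convolution_flip]
    congr 1
    ext; simp
  exact funext (key i j)

end Mollify

/-! ### Mollification of Sobolev maps -/

section WeakDeriv

variable {n : ℕ} {Ω : Set (Space n)} {f : Space n → Space n}
  {G : Space n → (Space n →L[ℝ] Space n)}

lemma locallyIntegrable_indicator {E : Type*} [NormedAddCommGroup E] (hΩ : MeasurableSet Ω)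
    {g : Space n → E} (hg : IntegrableOn g Ω) : LocallyIntegrable (Ω.indicator g) :=
  (hg.integrable_indicator hΩ).locallyIntegrable

/-- The derivative falls on the kernel, and the translated kernel is a test function on `Ω` because
its ball stays inside. Reflecting the kernel produces a sign that cancels the one in the definition
of the weak derivative. -/
lemma hasFDerivAt_mollify (hΩ : MeasurableSet Ω) (hf : IntegrableOn f Ω) (hG : IntegrableOn G Ω)
    (h : HasWeakDeriv Ω f G) {j : ℕ} {x : Space n}
    (hx : Metric.closedBall x ((1 / 2) ^ j) ⊆ Ω) :
    HasFDerivAt (mollify j (Ω.indicator f)) (mollify j (Ω.indicator G) x) x := by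
  have h1 := (mollifier_hasCompactSupport (n := n) j).hasFDerivAt_convolution_left
    (ContinuousLinearMap.lsmul ℝ ℝ) ((mollifier_contDiff j).of_le (by norm_cast))
    (locallyIntegrable_indicator hΩ hf) x
  refine h1.congr_fderiv ?_
  ext1 v
  have hψ : ContDiff ℝ ∞ fun z => mollifier n j (x - z) :=
    (mollifier_contDiff j).comp (contDiff_const.sub contDiff_id)
  have hts : tsupport (fun z => mollifier n j (x - z)) ⊆ Ω := by
    refine Subset.trans ?_ hx
    refine closure_minimal ?_ Metric.isClosed_closedBall
    intro z hz
    have : x - z ∈ Function.support (mollifier n j) := hz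
    rw [support_mollifier, Metric.mem_ball, dist_zero_right, ← dist_eq_norm, dist_comm] at this
    exact Metric.mem_closedBall.2 this.le
  have h2 := h.integral_eq _ hψ (mollifier_sub_hasCompactSupport j x) hts v
  have hd : ∀ z, fderiv ℝ (fun z => mollifier n j (x - z)) z v
      = - fderiv ℝ (mollifier n j) (x - z) v := by
    intro z
    have hm : HasFDerivAt (mollifier n j) (fderiv ℝ (mollifier n j) (x - z)) (x - z) :=
      (((mollifier_contDiff j).differentiable (by simp)) _).hasFDerivAt
    have := hm.comp z ((hasFDerivAt_id z).const_sub x)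
    have h3 : HasFDerivAt (fun z => mollifier n j (x - z)) _ z := this
    rw [h3.fderiv]
    simp
  simp_rw [hd, neg_smul, integral_neg, neg_inj] at h2
  rw [← integral_indicator hΩ, ← integral_indicator hΩ] at h2
  have hD : HasCompactSupport (fderiv ℝ (mollifier n j)) :=
    (mollifier_hasCompactSupport j).fderiv ℝ
  have hDc : Continuous (fderiv ℝ (mollifier n j)) :=
    (mollifier_contDiff j).continuous_fderiv (by simp)
  rw [mollify_apply, convolution_eq_swap,
    ContinuousLinearMap.integral_apply (mollifier_sub_integrable_smul j
      (locallyIntegrable_indicator hΩ hG) x),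
    ContinuousLinearMap.integral_apply]
  · refine Eq.trans (integral_congr_ae (.of_forall fun z => ?_))
      (h2.trans (integral_congr_ae (.of_forall fun z => ?_)))
    · by_cases hz : z ∈ Ω <;> simp [hz]
    · by_cases hz : z ∈ Ω <;> simp [hz]
  · have := (hD.convolutionExists_left ((ContinuousLinearMap.lsmul ℝ ℝ).precompL (Space n)) hDc
      (locallyIntegrable_indicator hΩ hf)) x
    have h4 := this.integrable_swap
    exact h4

/-- The averages that control the oscillation of the mollifications of `f` at scale `2^{-j}`. -/
noncomputable def oscBound (Ω : Set (Space n)) (G : Space n → (Space n →L[ℝ] Space n)) (j : ℕ)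
    (x : Space n) (L : Space n →L[ℝ] Space n) : ℝ :=
  mollifierBound n (j + 1) *
    ∫ t in Metric.closedBall x (2 * (1 / 2) ^ j), ‖Ω.indicator G t - L‖

/-- Mean value inequality on the ball of radius `2^{-j}`, where the derivative of the mollification
is close to `L`. The doubled radius in `oscBound` leaves room for the kernel, and the bound at level
`j + 1` dominates the one at level `j`, so both scales are covered. -/
lemma norm_mollify_image_sub_le (hΩ : MeasurableSet Ω) (hf : IntegrableOn f Ω)
    (hG : IntegrableOn G Ω) (h : HasWeakDeriv Ω f G) {i j : ℕ} (hij : i = j ∨ i = j + 1)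
    {x y : Space n} (hx : Metric.closedBall x (2 * (1 / 2) ^ j) ⊆ Ω)
    (hy : dist y x ≤ (1 / 2) ^ j) (L : Space n →L[ℝ] Space n) :
    ‖mollify i (Ω.indicator f) y - mollify i (Ω.indicator f) x - L (y - x)‖
      ≤ oscBound Ω G j x L * ‖y - x‖ := by
  have hp : (0 : ℝ) < (1 / 2) ^ j := by positivity
  have hi : ((1 : ℝ) / 2) ^ i ≤ (1 / 2) ^ j := by
    refine pow_le_pow_of_le_one (by norm_num) (by norm_num) ?_
    omega
  have hb : mollifierBound n i ≤ mollifierBound n (j + 1) := by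
    rcases hij with rfl | rfl
    · exact mollifierBound_le_succ _
    · exact le_rfl
  refine Convex.norm_image_sub_le_of_norm_hasFDerivWithin_le'
    (f' := mollify i (Ω.indicator G)) (s := Metric.closedBall x ((1 / 2) ^ j)) ?_ ?_
    (convex_closedBall _ _) (Metric.mem_closedBall_self hp.le) (Metric.mem_closedBall.2 hy)
  · intro z hz
    refine (hasFDerivAt_mollify hΩ hf hG h (Subset.trans ?_ hx)).hasFDerivWithinAt
    refine Metric.closedBall_subset_closedBall' ?_
    rw [Metric.mem_closedBall] at hz
    linarith
  · intro z hz
    rw [Metric.mem_closedBall] at hz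
    refine (norm_mollify_sub_le i (locallyIntegrable_indicator hΩ hG)
      (R := 2 * (1 / 2) ^ j) (x := x) (by linarith) L).trans ?_
    exact mul_le_mul_of_nonneg_right hb (integral_nonneg fun _ => norm_nonneg _)

/-- An even kernel integrates an odd function to zero. This lets the linear part be subtracted for
free when mollification errors are estimated. -/
lemma mollify_clm_sub (j : ℕ) (L : Space n →L[ℝ] Space n) (x : Space n) :
    mollify j (fun y => L (y - x)) x = 0 := by
  have h1 : mollify j (fun y => L (y - x)) x = ∫ t, mollifier n j t • L (-t) := by
    rw [mollify, convolution_def]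
    simp
  have h2 : ∫ t, mollifier n j t • L (-t) = - ∫ t, mollifier n j t • L (-t) := by
    conv_lhs => rw [← integral_neg_eq_self]
    rw [← integral_neg]
    congr 1
    ext1 t
    rw [mollifier_neg, neg_neg, map_neg, smul_neg, neg_neg]
  rw [h1]
  have h3 : (2 : ℝ) • ∫ t, mollifier n j t • L (-t) = 0 := by
    rw [two_smul]
    nth_rewrite 1 [h2]
    exact neg_add_cancel _
  exact (smul_eq_zero.1 h3).resolve_left two_ne_zero

lemma norm_mollify_mollify_sub_le (hΩ : MeasurableSet Ω) (hf : IntegrableOn f Ω)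
    (hG : IntegrableOn G Ω) (h : HasWeakDeriv Ω f G) {i i' j : ℕ} (hij : i = j ∨ i = j + 1)
    (hi' : j ≤ i') {x : Space n} (hx : Metric.closedBall x (2 * (1 / 2) ^ j) ⊆ Ω)
    (L : Space n →L[ℝ] Space n) :
    ‖mollify i' (mollify i (Ω.indicator f)) x - mollify i (Ω.indicator f) x‖
      ≤ oscBound Ω G j x L * (1 / 2) ^ j := by
  set F := mollify i (Ω.indicator f) with hF
  have hFc : Continuous F := mollify_continuous i (locallyIntegrable_indicator hΩ hf)
  have hLc : Continuous fun y => L (y - x) := by fun_prop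
  have e1 : mollify i' F x = mollify i' (fun y => F y - L (y - x)) x := by
    have h0 := mollify_clm_sub i' L x
    rw [mollify_apply] at h0 ⊢
    rw [mollify_apply]
    simp_rw [smul_sub]
    rw [integral_sub (mollifier_sub_integrable_smul i' hFc.locallyIntegrable x)
      (mollifier_sub_integrable_smul i' hLc.locallyIntegrable x), h0, sub_zero]
  have hos : 0 ≤ oscBound Ω G j x L :=
    mul_nonneg (mollifierBound_pos _).le (integral_nonneg fun _ => norm_nonneg _)
  rw [e1, ← dist_eq_norm]
  have hpi : ((1 : ℝ) / 2) ^ i' ≤ (1 / 2) ^ j :=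
    pow_le_pow_of_le_one (by norm_num) (by norm_num) hi'
  refine dist_convolution_le (R := (1 / 2) ^ i') (by positivity) (support_mollifier i').subset
    (mollifier_nonneg i') (integral_mollifier i') (hFc.sub hLc).aestronglyMeasurable ?_
  intro y hy
  rw [Metric.mem_ball] at hy
  rw [dist_eq_norm, sub_right_comm]
  refine (norm_mollify_image_sub_le hΩ hf hG h hij hx (hy.le.trans hpi) L).trans ?_
  gcongr
  rw [← dist_eq_norm]
  exact hy.le.trans hpi

/-- Both mollifications are compared with the double mollification at scales `j` and `j + 1`, which
does not depend on the order. -/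
lemma dist_mollify_succ_le (hΩ : MeasurableSet Ω) (hf : IntegrableOn f Ω)
    (hG : IntegrableOn G Ω) (h : HasWeakDeriv Ω f G) {j : ℕ}
    {x : Space n} (hx : Metric.closedBall x (2 * (1 / 2) ^ j) ⊆ Ω)
    (L : Space n →L[ℝ] Space n) :
    dist (mollify j (Ω.indicator f) x) (mollify (j + 1) (Ω.indicator f) x)
      ≤ 2 * oscBound Ω G j x L * (1 / 2) ^ j := by
  have h1 := norm_mollify_mollify_sub_le hΩ hf hG h (i := j) (i' := j + 1) (Or.inl rfl)
    (Nat.le_succ j) hx L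
  have h2 := norm_mollify_mollify_sub_le hΩ hf hG h (i := j + 1) (i' := j) (Or.inr rfl)
    le_rfl hx L
  rw [mollify_comm (j + 1) j (locallyIntegrable_indicator hΩ hf), ← dist_eq_norm] at h1
  rw [← dist_eq_norm] at h2
  rw [dist_comm] at h1
  have := dist_triangle (mollify j (Ω.indicator f) x)
    (mollify j (mollify (j + 1) (Ω.indicator f)) x) (mollify (j + 1) (Ω.indicator f) x)
  linarith

end WeakDeriv

/-! ### Sobolev maps are differentiable on large sets -/

section Decomposition

variable {n : ℕ} {Ω : Set (Space n)} {f : Space n → Space n}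
  {G : Space n → (Space n →L[ℝ] Space n)}

lemma mollifierBound_mul_volume (j : ℕ) (x : Space n) :
    mollifierBound n (j + 1) * volume.real (Metric.closedBall x (2 * (1 / 2) ^ j)) = 8 ^ n := by
  have hv : 0 < volume.real (Metric.ball (0 : Space n) 1) :=
    ENNReal.toReal_pos (Metric.measure_ball_pos volume _ one_pos).ne' measure_ball_lt_top.ne
  rw [mollifierBound, Measure.addHaar_real_closedBall _ _ (by positivity),
    Measure.addHaar_real_closedBall _ _ (by positivity), finrank_euclideanSpace_fin]
  -- The averaging ball has eight times the inner radius of the bump at level `j + 1`.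
  have h : (2 * (1 / 2) ^ j : ℝ) = 8 * ((1 / 2) ^ (j + 1) / 2) := by rw [pow_succ]; ring
  rw [h, mul_pow]
  field_simp

lemma ae_tendsto_oscBound (hΩ : MeasurableSet Ω) (hG : IntegrableOn G Ω) :
    ∀ᵐ x, x ∈ Ω → Tendsto (fun j => oscBound Ω G j x (G x)) atTop (𝓝 0) := by
  have h := IsUnifLocDoublingMeasure.ae_tendsto_average_norm_sub (volume : Measure (Space n))
    (locallyIntegrable_indicator hΩ hG) 1
  filter_upwards [h] with x hx hxΩ
  have h1 := hx (ι := ℕ) (l := atTop) (fun _ => x) (fun j => 2 * (1 / 2) ^ j) ?_ ?_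
  · have h2 := h1.const_mul ((8 : ℝ) ^ n)
    rw [mul_zero] at h2
    refine h2.congr fun j => ?_
    rw [setAverage_eq, oscBound, ← mollifierBound_mul_volume j x, indicator_of_mem hxΩ, smul_eq_mul]
    have : volume.real (Metric.closedBall x (2 * (1 / 2) ^ j)) ≠ 0 :=
      (volume_real_closedBall_pos x (by positivity)).ne'
    field_simp
  · refine tendsto_nhdsWithin_iff.2 ⟨?_, Eventually.of_forall fun j => ?_⟩
    · have := (tendsto_pow_atTop_nhds_zero_of_lt_one (r := (1 / 2 : ℝ)) (by norm_num)
        (by norm_num)).const_mul 2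
      simpa using this
    · exact mem_Ioi.2 (by positivity)
  · exact Eventually.of_forall fun j => Metric.mem_closedBall_self (by positivity)

lemma eventually_closedBall_subset (hΩ : IsOpen Ω) {x : Space n} (hx : x ∈ Ω) :
    ∃ J : ℕ, ∀ j ≥ J, Metric.closedBall x (2 * (1 / 2) ^ j) ⊆ Ω := by
  obtain ⟨ε, hε, h⟩ := Metric.isOpen_iff.1 hΩ x hx
  have h1 := (tendsto_pow_atTop_nhds_zero_of_lt_one (r := (1 / 2 : ℝ)) (by norm_num)
    (by norm_num)).const_mul 2
  rw [mul_zero] at h1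
  obtain ⟨J, hJ⟩ := eventually_atTop.1 (h1.eventually (gt_mem_nhds hε))
  exact ⟨J, fun j hj => (Metric.closedBall_subset_ball (hJ j hj)).trans h⟩

/-- Telescoping over the scales finer than `2^{-j}`: each step costs `o(1)` times its scale, and the
geometric series sums to `o(2^{-j})`. -/
lemma tendsto_scaled_dist_mollify (hΩ : IsOpen Ω) (hf : IntegrableOn f Ω)
    (hG : IntegrableOn G Ω) (h : HasWeakDeriv Ω f G) {x : Space n} (hx : x ∈ Ω)
    (hlim : Tendsto (fun j => mollify j (Ω.indicator f) x) atTop (𝓝 (f x)))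
    (hosc : Tendsto (fun j => oscBound Ω G j x (G x)) atTop (𝓝 0)) :
    Tendsto (fun j : ℕ => 2 ^ j * dist (mollify j (Ω.indicator f) x) (f x)) atTop (𝓝 0) := by
  obtain ⟨J, hJ⟩ := eventually_closedBall_subset hΩ hx
  rw [Metric.tendsto_atTop]
  intro ε hε
  obtain ⟨I, hI⟩ := eventually_atTop.1 (hosc.eventually (gt_mem_nhds (show 0 < ε / 8 by positivity)))
  refine ⟨max I J, fun j hj => ?_⟩
  have hj1 := le_of_max_le_left hj
  have hj2 := le_of_max_le_right hj
  have key := dist_le_of_le_geometric_two_of_tendsto (C := ε / 2 * (1 / 2) ^ j)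
    (f := fun i => mollify (i + j) (Ω.indicator f) x) (a := f x) ?_
    ((tendsto_add_atTop_iff_nat j).2 hlim) 0
  · simp only [zero_add, pow_zero, div_one] at key
    rw [dist_zero_right, Real.norm_of_nonneg (by positivity)]
    calc _ ≤ 2 ^ j * (ε / 2 * (1 / 2) ^ j) := by gcongr
      _ = ε / 2 := by rw [one_div, inv_pow]; field_simp
      _ < ε := by linarith
  · intro i
    have := dist_mollify_succ_le hΩ.measurableSet hf hG h (hJ (i + j) (by omega)) (G x)
    rw [show i + 1 + j = i + j + 1 by ring]
    refine this.trans ?_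
    have h8 := (hI (i + j) (by omega)).le
    calc _ ≤ 2 * (ε / 8) * (1 / 2) ^ (i + j) := by gcongr
      _ = _ := by rw [pow_add]; simp only [one_div, inv_pow]; field_simp; ring

/-- For `y ∈ S` near `x`, `f` is replaced at both points by its mollification at a scale comparable
to `|y - x|`. Uniformity on `S` is what controls the error at the moving point `y`. -/
lemma hasFDerivWithinAt_of_uniform (hΩ : IsOpen Ω) (hf : IntegrableOn f Ω)
    (hG : IntegrableOn G Ω) (h : HasWeakDeriv Ω f G) {S : Set (Space n)}
    (hunif : ∀ ε > 0, ∃ J : ℕ, ∀ j ≥ J, ∀ y ∈ S,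
      2 ^ j * dist (mollify j (Ω.indicator f) y) (f y) ≤ ε)
    {x : Space n} (hxΩ : x ∈ Ω) (hxS : x ∈ S)
    (hosc : Tendsto (fun j => oscBound Ω G j x (G x)) atTop (𝓝 0)) :
    HasFDerivWithinAt f (G x) S x := by
  obtain ⟨J, hJ⟩ := eventually_closedBall_subset hΩ hxΩ
  rw [hasFDerivWithinAt_iff_isLittleO, Asymptotics.isLittleO_iff]
  intro c hc
  obtain ⟨I, hI⟩ := eventually_atTop.1 (hosc.eventually (gt_mem_nhds (show 0 < c / 6 by positivity)))
  obtain ⟨K, hK⟩ := hunif (c / 6) (by positivity)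
  have hr : (0 : ℝ) < (1 / 2) ^ (max I (max J K)) := by positivity
  filter_upwards [self_mem_nhdsWithin, mem_nhdsWithin_of_mem_nhds (Metric.ball_mem_nhds x hr)]
    with y hyS hyx
  rw [Metric.mem_ball] at hyx
  rcases eq_or_ne y x with rfl | hne
  · simp
  obtain ⟨j, hj1, hj2⟩ := exists_nat_pow_near_of_lt_one (dist_pos.2 hne)
    (hyx.le.trans (pow_le_one₀ (by norm_num) (by norm_num))) (y := (1 / 2 : ℝ)) (by norm_num)
    (by norm_num)
  have hj : max I (max J K) ≤ j := by
    by_contra hcon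
    have h3 : j + 1 ≤ max I (max J K) := by omega
    have := pow_le_pow_of_le_one (show (0 : ℝ) ≤ 1 / 2 by norm_num) (by norm_num) h3
    linarith
  have hjI : I ≤ j := le_trans (le_max_left _ _) hj
  have hjJ : J ≤ j := le_trans (le_trans (le_max_left _ _) (le_max_right _ _)) hj
  have hjK : K ≤ j := le_trans (le_trans (le_max_right _ _) (le_max_right _ _)) hj
  have e1 := norm_mollify_image_sub_le hΩ.measurableSet hf hG h (i := j) (j := j) (Or.inl rfl)
    (hJ j hjJ) hj2 (G x)
  have e2 := hK j hjK x hxS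
  have e3 := hK j hjK y hyS
  have e4 := (hI j hjI).le
  have hpow : (2 : ℝ) ^ j * (1 / 2) ^ j = 1 := by rw [← mul_pow]; norm_num
  have hscale : ∀ d : ℝ, 2 ^ j * d ≤ c / 6 → d ≤ c / 6 * (1 / 2) ^ j := by
    intro d hd
    calc d = (2 ^ j * d) * (1 / 2) ^ j := by linear_combination (-d) * hpow
      _ ≤ _ := by gcongr
  replace e2 := hscale _ e2
  replace e3 := hscale _ e3
  rw [pow_succ] at hj1
  rw [dist_eq_norm] at hj1 e2 e3
  rw [norm_sub_rev] at e3
  have e5 : oscBound Ω G j x (G x) * ‖y - x‖ ≤ c / 6 * ‖y - x‖ := by gcongr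
  have e6 : f y - f x - (G x) (y - x) = (f y - mollify j (Ω.indicator f) y)
      + (mollify j (Ω.indicator f) x - f x)
      + (mollify j (Ω.indicator f) y - mollify j (Ω.indicator f) x - (G x) (y - x)) := by abel
  rw [e6]
  refine (norm_add₃_le).trans ?_
  -- The two replacement errors cost `c / 3` each and the linearization `c / 6`, in total less than
  -- `c`.
  have e7 : c / 6 * (1 / 2) ^ j ≤ c / 6 * (2 * ‖y - x‖) := by gcongr; linarith
  have e8 : 0 ≤ c * ‖y - x‖ := by positivity
  linarith

/-- A Sobolev map is, up to a null set, differentiable with derivative the weak derivative along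
countably many measurable sets. -/
theorem HasWeakDeriv.exists_hasFDerivWithinAt (hΩ : IsOpen Ω) (hfin : volume Ω ≠ ⊤)
    (hf : IntegrableOn f Ω) (hG : IntegrableOn G Ω) (h : HasWeakDeriv Ω f G) :
    ∃ S : ℕ → Set (Space n), (∀ m, MeasurableSet (S m)) ∧ (∀ m, S m ⊆ Ω) ∧
      volume (Ω \ ⋃ m, S m) = 0 ∧ ∀ m, ∀ x ∈ S m, HasFDerivWithinAt f (G x) (S m) x := by
  have hloc := locallyIntegrable_indicator hΩ.measurableSet hf
  -- Egorov's theorem below needs an honestly measurable limit, so `f` is traded for a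
  -- representative; the exceptional null set `N` is removed from the final sets.
  obtain ⟨f', hf'm, hf'⟩ := hloc.aestronglyMeasurable
  have hgood : ∀ᵐ x, x ∈ Ω → f x = f' x ∧
      Tendsto (fun j => oscBound Ω G j x (G x)) atTop (𝓝 0) ∧
      Tendsto (fun j : ℕ => 2 ^ j * dist (mollify j (Ω.indicator f) x) (f' x)) atTop (𝓝 0) := by
    filter_upwards [ae_tendsto_oscBound hΩ.measurableSet hG, ae_tendsto_mollify hloc, hf']
      with x h1 h2 h3 hx
    rw [indicator_of_mem hx] at h2 h3
    refine ⟨h3, h1 hx, ?_⟩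
    rw [← h3]
    exact tendsto_scaled_dist_mollify hΩ hf hG h hx h2 (h1 hx)
  obtain ⟨N, hN, hNm, hN0⟩ := exists_measurable_superset_of_null hgood
  have hN' : ∀ x ∉ N, x ∈ Ω → f x = f' x ∧
      Tendsto (fun j => oscBound Ω G j x (G x)) atTop (𝓝 0) ∧
      Tendsto (fun j : ℕ => 2 ^ j * dist (mollify j (Ω.indicator f) x) (f' x)) atTop (𝓝 0) := by
    intro x hx
    by_contra hcon
    exact hx (hN hcon)
  have heg := fun m : ℕ => tendstoUniformlyOn_of_ae_tendsto (μ := volume)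
    (f := fun (j : ℕ) x => 2 ^ j * dist (mollify j (Ω.indicator f) x) (f' x))
    (g := fun _ => 0)
    (fun j => ((mollify_continuous j hloc).stronglyMeasurable.dist hf'm).const_mul _)
    stronglyMeasurable_const hΩ.measurableSet hfin (hgood.mono fun x hx h => (hx h).2.2)
    (ε := 1 / ((m : ℝ) + 1)) (by positivity)
  choose t htΩ htm htv htu using heg
  refine ⟨fun m => (Ω \ t m) \ N, fun m => (hΩ.measurableSet.diff (htm m)).diff hNm,
    fun m => sdiff_subset.trans sdiff_subset, ?_, ?_⟩
  · have hsub : ∀ m : ℕ, volume (Ω \ ⋃ m, (Ω \ t m) \ N) ≤ ENNReal.ofReal (1 / ((m : ℝ) + 1)) := by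
      intro m
      refine le_trans ?_ (htv m)
      refine le_trans (measure_mono (t := t m ∪ N) ?_) ((measure_union_le _ _).trans (by simp [hN0]))
      rintro x ⟨hx, hx2⟩
      by_contra hcon
      rw [mem_union, not_or] at hcon
      exact hx2 (mem_iUnion.2 ⟨m, ⟨hx, hcon.1⟩, hcon.2⟩)
    have hlim : Tendsto (fun m : ℕ => ENNReal.ofReal (1 / ((m : ℝ) + 1))) atTop (𝓝 0) := by
      rw [← ENNReal.ofReal_zero]
      exact ENNReal.tendsto_ofReal tendsto_one_div_add_atTop_nhds_zero_nat
    exact le_antisymm (ge_of_tendsto' hlim hsub) bot_le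
  · rintro m x ⟨⟨hxΩ, hxt⟩, hxN⟩
    refine hasFDerivWithinAt_of_uniform hΩ hf hG h ?_ hxΩ ⟨⟨hxΩ, hxt⟩, hxN⟩ (hN' x hxN hxΩ).2.1
    intro ε hε
    obtain ⟨J, hJ⟩ := eventually_atTop.1 (Metric.tendstoUniformlyOn_iff.1 (htu m) ε hε)
    refine ⟨J, fun j hj y hy => ?_⟩
    have := hJ j hj y hy.1
    rw [dist_comm, Real.dist_0_eq_abs, abs_of_nonneg (by positivity)] at this
    rw [(hN' y hy.2 hy.1.1).1]
    exact this.le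

end Decomposition

/-! ### The weak derivative of a Sobolev map -/

section WeakDerivProps

variable {n : ℕ} {Ω : Set (Space n)} {f : Space n → Space n} {p : ℝ}
  {G G' : Space n → (Space n →L[ℝ] Space n)}

lemma integrableOn_testFun_smul {E : Type*} [NormedAddCommGroup E] [NormedSpace ℝ E]
    {g : Space n → E} (hg : LocallyIntegrableOn g Ω) {ψ : Space n → ℝ} (hψ : Continuous ψ)
    (hc : HasCompactSupport ψ) (hs : tsupport ψ ⊆ Ω) :
    Integrable (fun x => ψ x • g x) := by
  have h1 : IntegrableOn (fun x => ψ x • g x) (tsupport ψ) :=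
    (hg.integrableOn_compact_subset hs hc).continuousOn_smul hψ.continuousOn hc
  refine (integrableOn_iff_integrable_of_support_subset ?_).1 h1
  intro x hx
  refine subset_tsupport ψ ?_
  intro h0
  exact hx (by simp [h0])

/-- The fundamental lemma of the calculus of variations. It transfers integrability from the
derivative in `MemSobolev` to the chosen `weakDeriv`. -/
lemma HasWeakDeriv.ae_eq (hΩ : IsOpen Ω) (h : HasWeakDeriv Ω f G) (h' : HasWeakDeriv Ω f G') :
    G =ᵐ[volume.restrict Ω] G' := by
  have key := IsOpen.ae_eq_zero_of_integral_contDiff_smul_eq_zero (μ := volume)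
    (f := fun x => G x - G' x) hΩ (h.locInt_deriv.sub h'.locInt_deriv) ?_
  · rw [EventuallyEq, ae_restrict_iff' hΩ.measurableSet]
    filter_upwards [key] with x hx hxΩ
    exact sub_eq_zero.1 (hx hxΩ)
  · intro ψ hψ hc hs
    have i1 := integrableOn_testFun_smul h.locInt_deriv hψ.continuous hc hs
    have i2 := integrableOn_testFun_smul h'.locInt_deriv hψ.continuous hc hs
    simp_rw [smul_sub]
    rw [integral_sub i1 i2, sub_eq_zero]
    have hvan : ∀ (F : Space n → (Space n →L[ℝ] Space n)) (v : Space n),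
        ∫ x in Ω, ψ x • F x v = ∫ x, ψ x • F x v := fun F v =>
      setIntegral_eq_integral_of_forall_compl_eq_zero fun x hx => by
        rw [image_eq_zero_of_notMem_tsupport fun hx' => hx (hs hx'), zero_smul]
    ext1 v
    rw [ContinuousLinearMap.integral_apply i1, ContinuousLinearMap.integral_apply i2]
    have e1 := h.integral_eq ψ hψ hc hs v
    rw [h'.integral_eq ψ hψ hc hs v, neg_inj, hvan, hvan] at e1
    exact e1.symm

lemma MemSobolev.hasWeakDeriv (h : MemSobolev Ω p f) : HasWeakDeriv Ω f (weakDeriv Ω f) := by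
  obtain ⟨-, G, hG, -⟩ := h
  have hex : ∃ G, HasWeakDeriv Ω f G := ⟨G, hG⟩
  rw [weakDeriv, dif_pos hex]
  exact hex.choose_spec

lemma MemSobolev.integrableOn (h : MemSobolev Ω p f) (hp : 1 ≤ p) (hfin : volume Ω ≠ ⊤) :
    IntegrableOn f Ω := by
  have : IsFiniteMeasure (volume.restrict Ω) := ⟨by simpa using hfin.lt_top⟩
  exact h.1.integrable (by simpa using ENNReal.ofReal_le_ofReal hp)

lemma MemSobolev.integrableOn_weakDeriv (h : MemSobolev Ω p f) (hΩ : IsOpen Ω) (hp : 1 ≤ p)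
    (hfin : volume Ω ≠ ⊤) : IntegrableOn (weakDeriv Ω f) Ω := by
  have : IsFiniteMeasure (volume.restrict Ω) := ⟨by simpa using hfin.lt_top⟩
  obtain ⟨-, G, hG, hGp⟩ := id h
  have hi : IntegrableOn G Ω := hGp.integrable (by simpa using ENNReal.ofReal_le_ofReal hp)
  exact hi.congr (hG.ae_eq hΩ h.hasWeakDeriv)

end WeakDerivProps

/-! ### The change of variables formula -/

section Area

variable {n : ℕ} {Ω : Set (Space n)} {f f₀ : Space n → Space n} {p : ℝ} {A B : Set (Space n)}

lemma measurableSet_inter_preimage_of_continuousOn {U : Set (Space n)} (hU : MeasurableSet U)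
    (hf : ContinuousOn f U) (hB : MeasurableSet B) : MeasurableSet (U ∩ f ⁻¹' B) := by
  have h : Measurable (U.domRestrict f) := (continuousOn_iff_continuous_domRestrict.1 hf).measurable
  have h2 := hU.subtype_image (h hB)
  convert h2 using 1
  ext x
  simp [domRestrict, and_comm]

/-- The area formula for an injective Sobolev map with the Lusin `(N)` condition. -/
theorem HasWeakDeriv.lintegral_abs_det_eq {G : Space n → (Space n →L[ℝ] Space n)}
    (hΩ : IsOpen Ω) (hfin : volume Ω ≠ ⊤)
    (hf : IntegrableOn f Ω) (hG : IntegrableOn G Ω) (h : HasWeakDeriv Ω f G) (hN : LusinN Ω f)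
    {T : Set (Space n)} (hTm : MeasurableSet T) (hT : T ⊆ Ω) (hinj : InjOn f T) :
    ∫⁻ x in T, ENNReal.ofReal |(G x).det| = volume (f '' T) := by
  obtain ⟨S, hSm, -, hS0, hSd⟩ := h.exists_hasFDerivWithinAt hΩ hfin hf hG
  set R : ℕ → Set (Space n) := disjointed fun m => S m ∩ T with hR
  have hRsub : ∀ m, R m ⊆ S m ∩ T := fun m => disjointed_subset _ m
  have hRm : ∀ m, MeasurableSet (R m) :=
    MeasurableSet.disjointed fun m => (hSm m).inter hTm
  have hRd : Pairwise (Function.onFun Disjoint R) := disjoint_disjointed _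
  have hRU : ⋃ m, R m = (⋃ m, S m) ∩ T := by
    rw [hR, iUnion_disjointed, iUnion_inter]
  have hderiv : ∀ m, ∀ x ∈ R m, HasFDerivWithinAt f (G x) (R m) x := fun m x hx =>
    (hSd m x (hRsub m hx).1).mono ((hRsub m).trans inter_subset_left)
  have hRinj : ∀ m, InjOn f (R m) := fun m => hinj.mono ((hRsub m).trans inter_subset_right)
  have hrest : volume (T \ ⋃ m, R m) = 0 := by
    refine measure_mono_null ?_ hS0
    rintro x ⟨hxT, hx⟩
    refine ⟨hT hxT, fun hxS => hx ?_⟩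
    rw [hRU]
    exact ⟨hxS, hxT⟩
  have hUT : ⋃ m, R m ⊆ T := by rw [hRU]; exact inter_subset_right
  have hae : (⋃ m, R m : Set (Space n)) =ᵐ[volume] T :=
    (hUT.eventuallyLE).antisymm (ae_le_set.2 hrest)
  have himg : volume (f '' T) = volume (f '' ⋃ m, R m) := by
    refine le_antisymm ?_ (measure_mono (image_mono hUT))
    have : f '' T ⊆ f '' (⋃ m, R m) ∪ f '' (T \ ⋃ m, R m) := by
      rw [← image_union, union_sdiff_self]
      exact image_mono subset_union_right
    refine (measure_mono this).trans ((measure_union_le _ _).trans ?_)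
    -- Lusin `(N)`: the null set where `f` is not known to be differentiable along a piece has a
    -- null image.
    rw [hN _ (sdiff_subset.trans hT) hrest, add_zero]
  rw [← setLIntegral_congr hae, lintegral_iUnion hRm hRd, himg, image_iUnion, measure_iUnion]
  · refine tsum_congr fun m => ?_
    exact lintegral_abs_det_fderiv_eq_addHaar_image volume (hRm m) (hderiv m) (hRinj m)
  · intro i j hij
    refine disjoint_image_image fun x hx y hy hxy => ?_
    have := hinj (hRsub i hx).2 (hRsub j hy).2 hxy
    exact Set.disjoint_left.1 (hRd hij) hx (this ▸ hy)
  · exact fun m => measurable_image_of_fderivWithin (hRm m) (hderiv m) (hRinj m)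

variable [Nontrivial (Space n)]

/-- `U` is `Ω` without the finitely many cavitation points. What its image misses comes from `∂Ω`,
where `f = f₀`, and is null by assumption. -/
lemma HasCavitySet.exists_openDense (hΩ : IsOpen Ω) (hbd : volume (f₀ '' frontier Ω) = 0)
    (h : HasCavitySet Ω p f₀ f A) :
    ∃ U ⊆ Ω, IsOpen U ∧ volume (Ω \ U) = 0 ∧ ContinuousOn f U ∧ InjOn f U ∧
      f '' U ⊆ closure (f₀ '' Ω) \ A ∧ volume ((closure (f₀ '' Ω) \ A) \ f '' U) = 0 := by
  obtain ⟨m, x, K, hx, -, -, hemb, himg, rfl⟩ := h.exists_cavities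
  have hfin : (range x).Finite := finite_range x
  have hsub : Ω \ range x ⊆ closure Ω \ range x := sdiff_subset_sdiff_left subset_closure
  refine ⟨Ω \ range x, sdiff_subset, hΩ.sdiff hfin.isClosed, ?_, ?_, ?_, ?_, ?_⟩
  · refine measure_mono_null ?_ (hfin.measure_zero volume)
    rintro y ⟨h1, h2⟩
    by_contra h3
    exact h2 ⟨h1, h3⟩
  · exact (continuousOn_iff_continuous_domRestrict.2 hemb.continuous).mono hsub
  · exact (injOn_iff_injective.2 hemb.injective).mono hsub
  · rw [← himg]
    exact image_mono hsub
  · rw [← himg]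
    refine measure_mono_null ?_ hbd
    rintro _ ⟨⟨y, hy, rfl⟩, hy2⟩
    have hyΩ : y ∉ Ω := fun hyΩ => hy2 ⟨y, ⟨hyΩ, hy.2⟩, rfl⟩
    have hyf : y ∈ frontier Ω := ⟨hy.1, by rwa [hΩ.interior_eq]⟩
    exact ⟨y, hyf, (h.eqOn_frontier hyf).symm⟩

lemma HasCavitySet.aemeasurable (hΩ : IsOpen Ω) (hbd : volume (f₀ '' frontier Ω) = 0)
    (h : HasCavitySet Ω p f₀ f A) : AEMeasurable f (volume.restrict Ω) := by
  obtain ⟨U, hU, hUo, hU0, hc, -⟩ := h.exists_openDense hΩ hbd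
  have hae : (U : Set (Space n)) =ᵐ[volume] Ω := hU.eventuallyLE.antisymm (ae_le_set.2 hU0)
  rw [← Measure.restrict_congr_set hae]
  exact hc.aemeasurable hUo.measurableSet

/-- The change of variables formula for homeomorphisms with finitely many cavities. -/
theorem HasCavitySet.lintegral_abs_det_eq (hp : 1 ≤ p) (hΩ : IsOpen Ω) (hfin : volume Ω ≠ ⊤)
    (hbd : volume (f₀ '' frontier Ω) = 0) (h : HasCavitySet Ω p f₀ f A) (hB : MeasurableSet B) :
    ∫⁻ x in Ω ∩ f ⁻¹' B, ENNReal.ofReal |(weakDeriv Ω f x).det|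
      = volume ((closure (f₀ '' Ω) \ A) ∩ B) := by
  obtain ⟨U, hU, hUo, hU0, hc, hinj, hsub, hsub0⟩ := h.exists_openDense hΩ hbd
  have hae : (U ∩ f ⁻¹' B : Set (Space n)) =ᵐ[volume] (Ω ∩ f ⁻¹' B : Set (Space n)) := by
    refine (inter_subset_inter_left _ hU).eventuallyLE.antisymm (ae_le_set.2 ?_)
    refine measure_mono_null ?_ hU0
    rintro x ⟨⟨h1, h2⟩, h3⟩
    exact ⟨h1, fun h4 => h3 ⟨h4, h2⟩⟩
  rw [← setLIntegral_congr hae, h.mem_sobolev.hasWeakDeriv.lintegral_abs_det_eq hΩ hfin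
    (h.mem_sobolev.integrableOn hp hfin) (h.mem_sobolev.integrableOn_weakDeriv hΩ hp hfin) h.lusin
    (measurableSet_inter_preimage_of_continuousOn hUo.measurableSet hc hB)
    (inter_subset_left.trans hU) (hinj.mono inter_subset_left), image_inter_preimage]
  refine measure_congr ((inter_subset_inter_left _ hsub).eventuallyLE.antisymm (ae_le_set.2 ?_))
  refine measure_mono_null ?_ hsub0
  rintro x ⟨⟨h1, h2⟩, h3⟩
  exact ⟨h1, fun h4 => h3 ⟨h4, h2⟩⟩

end Area

/-! ### Consequences of the growth of `φ` -/

section Growth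

variable {φ : ℝ → ℝ}

lemma GrowthAssumptions.exists_le_extend (hφ : GrowthAssumptions φ) (M : ℝ) :
    ∃ δ > 0, ∀ t ≤ δ, ENNReal.ofReal M ≤ extend φ t := by
  have h := hφ.tendsto_zero.eventually_ge_atTop M
  obtain ⟨δ, hδ, hsub⟩ := mem_nhdsGT_iff_exists_Ioc_subset.1 h
  refine ⟨δ, hδ, fun t ht => ?_⟩
  rw [extend]
  split_ifs with h0
  · exact ENNReal.ofReal_le_ofReal (hsub ⟨h0, ht⟩)
  · exact le_top

/-- Superlinearity in the form of de la Vallée Poussin: it gives equi-integrability of densities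
with bounded `φ`-energy. -/
lemma GrowthAssumptions.exists_ofReal_le (hφ : GrowthAssumptions φ) {ε : ℝ} (hε : 0 < ε) :
    ∃ M : ℝ, ∀ t, ENNReal.ofReal t ≤ ENNReal.ofReal M + ENNReal.ofReal ε * extend φ t := by
  obtain ⟨M, hM⟩ := eventually_atTop.1 (hφ.tendsto_top.eventually_ge_atTop (1 / ε))
  refine ⟨max M 0, fun t => ?_⟩
  rcases le_or_gt t (max M 0) with h | h
  · exact (ENNReal.ofReal_le_ofReal h).trans le_self_add
  · have ht : 0 < t := (le_max_right _ _).trans_lt h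
    have h1 := hM t ((le_max_left _ _).trans h.le)
    rw [div_le_div_iff₀ hε ht, one_mul] at h1
    rw [extend, if_pos ht, ← ENNReal.ofReal_mul hε.le]
    refine le_trans (ENNReal.ofReal_le_ofReal ?_) le_add_self
    linarith

end Growth

/-! ### Limits of maps that transport a density to the complement of a set -/

section Transport

variable {n : ℕ} {α : Type*} [MeasurableSpace α]

/-- The maps `u k` transport the measures `J k μ`, whose `φ`-energy is bounded by `C`, to the volume
on `D ∖ A k`, and they converge to `v`, whereas the sets `A k` converge to `B`. -/
structure TransportLimit (μ : Measure α) (φ : ℝ → ℝ) (C : ℝ≥0∞) (D : Set (Space n))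
    (u : ℕ → α → Space n) (J : ℕ → α → ℝ) (A : ℕ → Set (Space n)) (v : α → Space n)
    (B : Set (Space n)) : Prop where
  aemeasurable : ∀ k, AEMeasurable (u k) μ
  aemeasurable_density : ∀ k, AEMeasurable (J k) μ
  energy_le : ∀ k, ∫⁻ x, extend φ (J k x) ∂μ ≤ C
  transport : ∀ k S, MeasurableSet S →
    ∫⁻ x in u k ⁻¹' S, ENNReal.ofReal (J k x) ∂μ = volume ((D \ A k) ∩ S)
  subset : ∀ k, A k ⊆ D
  tendsto : ∀ᵐ x ∂μ, Tendsto (fun k => u k x) atTop (𝓝 (v x))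
  tendsto_sets : TendstoInMeas A B

variable {μ : Measure α} {φ : ℝ → ℝ} {C : ℝ≥0∞} {D : Set (Space n)} {u : ℕ → α → Space n}
  {J : ℕ → α → ℝ} {A : ℕ → Set (Space n)} {v : α → Space n} {B S : Set (Space n)}

/-- If `v x` lies in the open set `U`, then so does `u k x` for all large `k`; thus the preimage
under `v` lies a.e. in the lower limit of the preimages. -/
lemma measure_preimage_le_of_isOpen {U : Set (Space n)} (hU : IsOpen U)
    (h : ∀ᵐ x ∂μ, Tendsto (fun k => u k x) atTop (𝓝 (v x))) {b : ℝ≥0∞}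
    (hb : ∀ᶠ k in atTop, μ (u k ⁻¹' U) ≤ b) : μ (v ⁻¹' U) ≤ b := by
  obtain ⟨K, hK⟩ := eventually_atTop.1 hb
  have hmono : Monotone fun m : ℕ => ⋂ k ≥ m, u k ⁻¹' U := fun i j hij =>
    biInter_subset_biInter_left fun k (hk : j ≤ k) => hij.trans hk
  have h1 : μ (v ⁻¹' U) ≤ μ (⋃ m : ℕ, ⋂ k ≥ m, u k ⁻¹' U) := by
    refine measure_mono_ae ?_
    filter_upwards [h] with x hx hxU
    obtain ⟨m, hm⟩ := eventually_atTop.1 (hx.eventually (hU.mem_nhds hxU))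
    exact mem_iUnion.2 ⟨m, mem_iInter₂.2 hm⟩
  refine h1.trans ?_
  rw [hmono.measure_iUnion]
  refine iSup_le fun m => ?_
  refine (measure_mono (iInter₂_subset (max m K) (le_max_left m K))).trans (hK _ (le_max_right _ _))

/-- For closed `K` the upper limit of the preimages lies a.e. in the preimage under `v`; finiteness
of `μ` gives continuity from above. -/
lemma tendsto_measure_preimage_zero [IsFiniteMeasure μ] {K : Set (Space n)} (hK : IsClosed K)
    (hu : ∀ k, AEMeasurable (u k) μ)
    (h : ∀ᵐ x ∂μ, Tendsto (fun k => u k x) atTop (𝓝 (v x))) (h0 : μ (v ⁻¹' K) = 0) :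
    Tendsto (fun k => μ (u k ⁻¹' K)) atTop (𝓝 0) := by
  have hanti : Antitone fun m : ℕ => ⋃ k ≥ m, u k ⁻¹' K := fun i j hij =>
    biUnion_subset_biUnion_left fun k (hk : j ≤ k) => hij.trans hk
  have h1 := tendsto_measure_iInter_atTop (μ := μ) (s := fun m : ℕ => ⋃ k ≥ m, u k ⁻¹' K)
    (fun m => .iUnion fun k => .iUnion fun _ => (hu k).nullMeasurableSet_preimage hK.measurableSet)
    hanti ⟨0, measure_ne_top _ _⟩
  have h2 : μ (⋂ m : ℕ, ⋃ k ≥ m, u k ⁻¹' K) = 0 := by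
    refine le_antisymm (le_trans (measure_mono_ae ?_) h0.le) bot_le
    filter_upwards [h] with x hx hxK
    by_contra hcon
    obtain ⟨m, hm⟩ := eventually_atTop.1 (hx.eventually (hK.isOpen_compl.mem_nhds hcon))
    obtain ⟨k, hk, hk2⟩ := mem_iUnion₂.1 (mem_iInter.1 hxK m)
    exact hm k hk hk2
  rw [h2] at h1
  refine tendsto_of_tendsto_of_tendsto_of_le_of_le tendsto_const_nhds h1 (fun _ => bot_le)
    fun m => measure_mono ?_
  exact subset_biUnion_of_mem (u := fun k => u k ⁻¹' K) (show m ∈ {k | k ≥ m} from le_refl m)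

/-- Chebyshev's inequality for `extend φ`, with a level `M` above `C / η`. The point is that `δ`
does not depend on the density. -/
lemma exists_measure_density_le (hφ : GrowthAssumptions φ) (hC : C ≠ ⊤) {η : ℝ≥0∞} (hη : η ≠ 0) :
    ∃ δ > 0, ∀ j : α → ℝ, AEMeasurable j μ → ∫⁻ x, extend φ (j x) ∂μ ≤ C →
      μ {x | j x ≤ δ} ≤ η := by
  set M : ℝ := (C / η).toReal + 1 with hM
  have hM0 : 0 < M := by positivity
  obtain ⟨δ, hδ, h⟩ := hφ.exists_le_extend M
  refine ⟨δ, hδ, fun j hj hE => ?_⟩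
  have hm : NullMeasurableSet {x | j x ≤ δ} μ := nullMeasurableSet_le hj aemeasurable_const
  have h1 : ENNReal.ofReal M * μ {x | j x ≤ δ} ≤ C := by
    rw [← lintegral_indicator_const₀ hm]
    refine (lintegral_mono fun x => ?_).trans hE
    by_cases hx : x ∈ {x | j x ≤ δ}
    · rw [indicator_of_mem hx]; exact h _ hx
    · rw [indicator_of_notMem hx]; exact bot_le
  have h2 : C ≤ ENNReal.ofReal M * η := by
    rw [← ENNReal.div_le_iff_le_mul (Or.inl hη) (Or.inr (by simpa using hM0)),
      ENNReal.le_ofReal_iff_toReal_le (ENNReal.div_ne_top hC hη) hM0.le]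
    rw [hM]; linarith
  exact (ENNReal.mul_le_mul_iff_right (by simpa using hM0) ENNReal.ofReal_ne_top).1 (h1.trans h2)

lemma ae_pos_of_lintegral_extend_le (hφ : GrowthAssumptions φ) (hC : C ≠ ⊤) {j : α → ℝ}
    (hj : AEMeasurable j μ) (hE : ∫⁻ x, extend φ (j x) ∂μ ≤ C) : ∀ᵐ x ∂μ, 0 < j x := by
  rw [ae_iff]
  refine le_antisymm (le_of_forall_pos_le_add fun η hη => ?_) bot_le
  obtain ⟨δ, hδ, h⟩ := exists_measure_density_le (μ := μ) hφ hC hη.ne'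
  rw [zero_add]
  refine (measure_mono fun x hx => ?_).trans (h j hj hE)
  exact (not_lt.1 hx).trans hδ.le

lemma measure_sdiff_inter_le (D A B S : Set (Space n)) :
    volume ((D \ A) ∩ S) ≤ volume ((D \ B) ∩ S) + volume (A ∆ B) := by
  refine (measure_mono ?_).trans (measure_union_le _ _)
  rintro x ⟨⟨h1, h2⟩, h3⟩
  by_cases hB : x ∈ B
  · exact Or.inr (Or.inr ⟨hB, h2⟩)
  · exact Or.inl ⟨⟨h1, hB⟩, h3⟩

lemma TransportLimit.measure_preimage_eq_zero (hφ : GrowthAssumptions φ) (hC : C ≠ ⊤)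
    (hD : volume D ≠ ⊤) (h : TransportLimit μ φ C D u J A v B) (hS : MeasurableSet S)
    (h0 : volume ((D \ B) ∩ S) = 0) : μ (v ⁻¹' S) = 0 := by
  have hfin : IsFiniteMeasure (volume.restrict (D \ B)) :=
    ⟨by simpa using (measure_mono sdiff_subset).trans_lt hD.lt_top⟩
  refine le_antisymm (ENNReal.le_of_forall_pos_le_add fun ε hε _ => ?_) bot_le
  rw [zero_add]
  set η : ℝ≥0∞ := ε / 3 with hηdef
  have hη : η ≠ 0 := by simp [hηdef, hε.ne']
  have hηε : η + (η + η) = ε := by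
    rw [← add_assoc, hηdef, ENNReal.add_thirds]
  obtain ⟨δ, hδ, hδ'⟩ := exists_measure_density_le (μ := μ) hφ hC hη
  -- `ε` is split in three: one `η` for the set where the density is at most `δ`; on the rest, the
  -- transported mass, below `δ (η + η)`, bounds the measure, one `η` coming from `U` and one from
  -- `A k ∆ B`.
  have hδ0 : ENNReal.ofReal δ ≠ 0 := by simpa using hδ
  have hε' : 0 < ENNReal.ofReal δ * η := pos_iff_ne_zero.2 (mul_ne_zero hδ0 hη)
  obtain ⟨U, hSU, hU, hUv⟩ := S.exists_isOpen_lt_of_lt (μ := volume.restrict (D \ B)) _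
    (show volume.restrict (D \ B) S < ENNReal.ofReal δ * η by
      rwa [Measure.restrict_apply hS, inter_comm, h0])
  rw [Measure.restrict_apply hU.measurableSet, inter_comm] at hUv
  refine (measure_mono (preimage_mono hSU)).trans (measure_preimage_le_of_isOpen hU h.tendsto ?_)
  filter_upwards [h.tendsto_sets.eventually (gt_mem_nhds hε')] with k hk
  have h1 : μ (u k ⁻¹' U) ≤ μ {x | J k x ≤ δ} + μ ({x | ENNReal.ofReal δ ≤ ENNReal.ofReal (J k x)}
      ∩ u k ⁻¹' U) := by
    refine (measure_mono fun x hx => ?_).trans (measure_union_le _ _)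
    rcases le_total (J k x) δ with hj | hj
    · exact Or.inl hj
    · exact Or.inr ⟨ENNReal.ofReal_le_ofReal hj, hx⟩
  have h2 : ENNReal.ofReal δ * μ ({x | ENNReal.ofReal δ ≤ ENNReal.ofReal (J k x)} ∩ u k ⁻¹' U)
      ≤ ENNReal.ofReal δ * (η + η) := by
    calc _ ≤ ENNReal.ofReal δ *
          μ.restrict (u k ⁻¹' U) {x | ENNReal.ofReal δ ≤ ENNReal.ofReal (J k x)} :=
          by exact mul_le_mul_right (Measure.le_restrict_apply _ _) _
      _ ≤ ∫⁻ x in u k ⁻¹' U, ENNReal.ofReal (J k x) ∂μ :=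
          mul_meas_ge_le_lintegral₀ (h.aemeasurable_density k).ennreal_ofReal.restrict _
      _ = volume ((D \ A k) ∩ U) := h.transport k U hU.measurableSet
      _ ≤ volume ((D \ B) ∩ U) + volume (A k ∆ B) := measure_sdiff_inter_le _ _ _ _
      _ ≤ _ := by rw [mul_add]; exact add_le_add hUv.le hk.le
  rw [ENNReal.mul_le_mul_iff_right hδ0 ENNReal.ofReal_ne_top] at h2
  rw [← hηε]
  exact h1.trans (add_le_add (hδ' _ (h.aemeasurable_density k) (h.energy_le k)) h2)

lemma TransportLimit.volume_inter_eq_zero [IsFiniteMeasure μ] (hφ : GrowthAssumptions φ)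
    (hC : C ≠ ⊤) (hD : volume D ≠ ⊤) (h : TransportLimit μ φ C D u J A v B)
    (hS : MeasurableSet S) (h0 : μ (v ⁻¹' S) = 0) : volume ((D \ B) ∩ S) = 0 := by
  have hfin : IsFiniteMeasure (volume.restrict (D \ B)) :=
    ⟨by simpa using (measure_mono sdiff_subset).trans_lt hD.lt_top⟩
  rw [inter_comm, ← Measure.restrict_apply hS, hS.measure_eq_iSup_isCompact]
  simp only [ENNReal.iSup_eq_zero]
  intro K hKS hK
  rw [Measure.restrict_apply hK.measurableSet, inter_comm]
  refine le_antisymm (ENNReal.le_of_forall_pos_le_add fun ε hε _ => ?_) bot_le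
  rw [zero_add]
  -- With the energy term absorbed into `ε`, the density behaves as if bounded by `M`, and the
  -- preimages of the compact set `K` have vanishing measure.
  obtain ⟨e, he, heC⟩ : ∃ e : ℝ, 0 < e ∧ ENNReal.ofReal e * C ≤ ε := by
    refine ⟨ε / (C.toReal + 1), by positivity, ?_⟩
    have hCe : C = ENNReal.ofReal C.toReal := (ENNReal.ofReal_toReal hC).symm
    nth_rewrite 2 [hCe]
    rw [← ENNReal.ofReal_mul (by positivity), ← ENNReal.ofReal_coe_nnreal]
    refine ENNReal.ofReal_le_ofReal ?_
    rw [div_mul_eq_mul_div, div_le_iff₀ (by positivity)]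
    have : (0 : ℝ) ≤ ε := ε.2
    nlinarith
  obtain ⟨M, hM⟩ := hφ.exists_ofReal_le he
  have hz := tendsto_measure_preimage_zero hK.isClosed h.aemeasurable h.tendsto
    (measure_mono_null (preimage_mono hKS) h0)
  have hb : ∀ k, volume ((D \ B) ∩ K) ≤
      (ENNReal.ofReal M * μ (u k ⁻¹' K) + volume (A k ∆ B)) + ε := by
    intro k
    have e1 : volume ((D \ A k) ∩ K) ≤ ENNReal.ofReal M * μ (u k ⁻¹' K) + ε := by
      rw [← h.transport k K hK.measurableSet]
      refine (lintegral_mono fun x => hM (J k x)).trans ?_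
      rw [lintegral_add_left measurable_const, setLIntegral_const, lintegral_const_mul' _ _
        ENNReal.ofReal_ne_top]
      refine add_le_add le_rfl (le_trans ?_ heC)
      gcongr
      exact (setLIntegral_le_lintegral _ _).trans (h.energy_le k)
    refine (measure_sdiff_inter_le D B (A k) K).trans ?_
    rw [symmDiff_comm B, add_right_comm]
    exact add_le_add e1 le_rfl
  refine ge_of_tendsto' (x := atTop) (f := fun k => (ENNReal.ofReal M * μ (u k ⁻¹' K)
    + volume (A k ∆ B)) + ε) ?_ hb
  have ht := ((ENNReal.Tendsto.const_mul (a := ENNReal.ofReal M) hz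
    (Or.inr ENNReal.ofReal_ne_top)).add h.tendsto_sets).add_const (ε : ℝ≥0∞)
  simpa using ht

/-- The limit of the cavity sets is determined by the limit of the maps. -/
theorem TransportLimit.volume_sdiff_eq_zero [IsFiniteMeasure μ] (hφ : GrowthAssumptions φ)
    (hC : C ≠ ⊤) (hD : volume D ≠ ⊤) (hDm : NullMeasurableSet D volume)
    {u' : ℕ → α → Space n} {J' : ℕ → α → ℝ} {A' : ℕ → Set (Space n)} {B' : Set (Space n)}
    (h : TransportLimit μ φ C D u J A v B) (h' : TransportLimit μ φ C D u' J' A' v B')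
    (hB' : NullMeasurableSet B' volume) : volume (B' \ B) = 0 := by
  -- Null sets are passed through the common limit map `v`. Testing with the complement of `D \ B'`
  -- then compares the two sets themselves.
  have hac : volume.restrict (D \ B) ≪ volume.restrict (D \ B') := by
    refine Measure.AbsolutelyContinuous.mk fun S hS h0 => ?_
    rw [Measure.restrict_apply hS, inter_comm] at h0 ⊢
    exact h.volume_inter_eq_zero hφ hC hD hS (h'.measure_preimage_eq_zero hφ hC hD hS h0)
  have h1 : volume.restrict (D \ B) (D \ B')ᶜ = 0 := by
    refine hac ?_
    rw [Measure.restrict_apply₀' (hDm.diff hB'), compl_inter_self, measure_empty]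
  have h2 : volume (B' \ D) = 0 := by
    refine le_antisymm (ge_of_tendsto' h'.tendsto_sets fun k => measure_mono ?_) bot_le
    exact fun x hx => Or.inr ⟨hx.1, fun hA => hx.2 (h'.subset k hA)⟩
  refine measure_mono_null (t := ((D \ B')ᶜ ∩ (D \ B)) ∪ (B' \ D)) ?_ ?_
  · rintro x ⟨h3, h4⟩
    by_cases hx : x ∈ D
    · exact Or.inl ⟨fun h5 => h5.2 h3, hx, h4⟩
    · exact Or.inr ⟨h3, hx⟩
  · refine measure_union_null ?_ h2
    exact le_antisymm ((Measure.le_restrict_apply _ _).trans h1.le) bot_le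

end Transport

/-! ### Compactness of bounded sequences of Sobolev maps -/

section Rellich

variable {n : ℕ} {Ω : Set (Space n)} {f : Space n → Space n} {p : ℝ}
  {G : Space n → (Space n →L[ℝ] Space n)}

lemma aemeasurable_enorm_indicator {E : Type*} [NormedAddCommGroup E] (hΩ : MeasurableSet Ω)
    {g : Space n → E} (hg : IntegrableOn g Ω) : AEMeasurable fun t => ‖Ω.indicator g t‖ₑ :=
  (hg.integrable_indicator hΩ).aestronglyMeasurable.enorm

lemma ofReal_setIntegral_norm_indicator {E : Type*} [NormedAddCommGroup E] (hΩ : MeasurableSet Ω)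
    {g : Space n → E} (hg : IntegrableOn g Ω) (S : Set (Space n)) :
    ENNReal.ofReal (∫ t in S, ‖Ω.indicator g t‖) = ∫⁻ t in S, ‖Ω.indicator g t‖ₑ :=
  ofReal_integral_norm_eq_lintegral_enorm (hg.integrable_indicator hΩ).integrableOn

lemma lintegral_enorm_indicator {E : Type*} [NormedAddCommGroup E] (hΩ : MeasurableSet Ω)
    (g : Space n → E) : ∫⁻ t, ‖Ω.indicator g t‖ₑ = ∫⁻ t in Ω, ‖g t‖ₑ := by
  simp_rw [enorm_indicator_eq_indicator_enorm]
  exact lintegral_indicator hΩ _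

lemma lintegral_closedBall_eq (g : Space n → ℝ≥0∞) (r : ℝ) (x : Space n) :
    ∫⁻ t in Metric.closedBall x r, g t
      = ∫⁻ t, {q : Space n × Space n | dist q.2 q.1 ≤ r}.indicator (fun q => g q.2) (x, t) := by
  rw [← lintegral_indicator Metric.isClosed_closedBall.measurableSet]
  rfl

lemma measurableSet_dist_le (r : ℝ) :
    MeasurableSet {q : Space n × Space n | dist q.2 q.1 ≤ r} :=
  (isClosed_le (continuous_snd.dist continuous_fst) continuous_const).measurableSet

lemma measurable_lintegral_closedBall {g : Space n → ℝ≥0∞} (hg : AEMeasurable g) (r : ℝ) :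
    Measurable fun x => ∫⁻ t in Metric.closedBall x r, g t := by
  have h : (fun x => ∫⁻ t in Metric.closedBall x r, g t)
      = fun x => ∫⁻ t in Metric.closedBall x r, hg.mk g t := by
    ext x
    exact lintegral_congr_ae (ae_restrict_of_ae hg.ae_eq_mk)
  rw [h]
  simp_rw [lintegral_closedBall_eq]
  exact ((hg.measurable_mk.comp measurable_snd).indicator
    (measurableSet_dist_le r)).lintegral_prod_right'

/-- Tonelli: the centres whose ball contains `t` form the ball around `t`. -/
lemma lintegral_lintegral_closedBall {g : Space n → ℝ≥0∞} (hg : AEMeasurable g) (r : ℝ) :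
    ∫⁻ x, ∫⁻ t in Metric.closedBall x r, g t
      = volume (Metric.closedBall (0 : Space n) r) * ∫⁻ t, g t := by
  simp_rw [lintegral_closedBall_eq]
  rw [lintegral_lintegral_swap]
  · rw [← lintegral_const_mul'' _ hg]
    refine lintegral_congr fun t => ?_
    have : ∀ x, {q : Space n × Space n | dist q.2 q.1 ≤ r}.indicator (fun q => g q.2) (x, t)
        = (Metric.closedBall t r).indicator (fun _ => g t) x := by
      intro x
      simp only [indicator, mem_ofPred_eq, Metric.mem_closedBall, dist_comm x t]
    simp_rw [this]
    rw [lintegral_indicator_const Metric.isClosed_closedBall.measurableSet, mul_comm,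
      Measure.addHaar_closedBall_center]
  · exact (hg.comp_quasiMeasurePreserving Measure.quasiMeasurePreserving_snd).indicator
      (measurableSet_dist_le r)

/-- The points of `Ω` at distance more than `2^{1-j}` from the complement. -/
def innerPart (Ω : Set (Space n)) (j : ℕ) : Set (Space n) :=
  {x | ENNReal.ofReal (2 * (1 / 2) ^ j) < Metric.infEDist x Ωᶜ}

lemma isOpen_innerPart (j : ℕ) : IsOpen (innerPart Ω j) :=
  isOpen_lt continuous_const Metric.continuous_infEDist

lemma two_mul_half_pow_anti {i j : ℕ} (hij : i ≤ j) :
    (2 * (1 / 2) ^ j : ℝ) ≤ 2 * (1 / 2) ^ i := by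
  gcongr 2 * ?_
  exact pow_le_pow_of_le_one (by norm_num) (by norm_num) hij

lemma innerPart_mono {i j : ℕ} (hij : i ≤ j) : innerPart Ω i ⊆ innerPart Ω j := fun _ hx =>
  (ENNReal.ofReal_le_ofReal (two_mul_half_pow_anti hij)).trans_lt hx

lemma closedBall_subset_of_mem_innerPart {j : ℕ} {x : Space n} (hx : x ∈ innerPart Ω j) :
    Metric.closedBall x (2 * (1 / 2) ^ j) ⊆ Ω := by
  intro y hy
  by_contra hcon
  have h1 : Metric.infEDist x Ωᶜ ≤ edist x y := Metric.infEDist_le_edist_of_mem hcon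
  rw [edist_dist, dist_comm] at h1
  exact absurd (hx.trans_le (h1.trans (ENNReal.ofReal_le_ofReal hy))) (lt_irrefl _)

lemma innerPart_subset (j : ℕ) : innerPart Ω j ⊆ Ω := fun _ hx =>
  closedBall_subset_of_mem_innerPart hx (Metric.mem_closedBall_self (by positivity))

lemma iUnion_innerPart (hΩ : IsOpen Ω) : ⋃ j, innerPart Ω j = Ω := by
  refine subset_antisymm (iUnion_subset innerPart_subset) fun x hx => ?_
  have h0 : 0 < Metric.infEDist x Ωᶜ := by
    rw [Metric.infEDist_pos_iff_notMem_closure, hΩ.isClosed_compl.closure_eq]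
    exact fun h => h hx
  have h1 : Tendsto (fun j : ℕ => ENNReal.ofReal (2 * (1 / 2) ^ j)) atTop (𝓝 0) := by
    have := ENNReal.tendsto_ofReal ((tendsto_pow_atTop_nhds_zero_of_lt_one (r := (1 / 2 : ℝ))
      (by norm_num) (by norm_num)).const_mul 2)
    simpa using this
  obtain ⟨j, hj⟩ := (h1.eventually (gt_mem_nhds h0)).exists
  exact mem_iUnion.2 ⟨j, hj⟩

lemma tendsto_volume_sdiff_innerPart (hΩ : IsOpen Ω) (hfin : volume Ω ≠ ⊤) :
    Tendsto (fun j => volume (Ω \ innerPart Ω j)) atTop (𝓝 0) := by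
  have h := tendsto_measure_iInter_atTop (μ := volume) (s := fun j => Ω \ innerPart Ω j)
    (fun j => (hΩ.measurableSet.diff (isOpen_innerPart j).measurableSet).nullMeasurableSet)
    (fun i j hij => sdiff_subset_sdiff_right (innerPart_mono hij))
    ⟨0, ((measure_mono sdiff_subset).trans_lt hfin.lt_top).ne⟩
  rwa [← sdiff_iUnion, iUnion_innerPart hΩ, sdiff_self, measure_empty] at h

lemma ofReal_oscBound_zero (hΩ : MeasurableSet Ω) (hG : IntegrableOn G Ω) (j : ℕ) (x : Space n) :
    ENNReal.ofReal (oscBound Ω G j x 0) = ENNReal.ofReal (mollifierBound n (j + 1)) *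
      ∫⁻ t in Metric.closedBall x (2 * (1 / 2) ^ j), ‖Ω.indicator G t‖ₑ := by
  rw [oscBound, ENNReal.ofReal_mul (mollifierBound_pos _).le]
  simp_rw [sub_zero]
  rw [ofReal_setIntegral_norm_indicator hΩ hG]

lemma lintegral_ofReal_oscBound_zero (hΩ : MeasurableSet Ω) (hG : IntegrableOn G Ω) (j : ℕ) :
    ∫⁻ x, ENNReal.ofReal (oscBound Ω G j x 0) = 8 ^ n * ∫⁻ x in Ω, ‖G x‖ₑ := by
  simp_rw [ofReal_oscBound_zero hΩ hG]
  have hm : AEMeasurable fun t => ‖Ω.indicator G t‖ₑ :=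
    aemeasurable_enorm_indicator hΩ hG
  rw [lintegral_const_mul _ (measurable_lintegral_closedBall hm _),
    lintegral_lintegral_closedBall hm, ← mul_assoc]
  congr 1
  · have := mollifierBound_mul_volume j (0 : Space n)
    rw [← ENNReal.ofReal_toReal (measure_closedBall_lt_top (x := (0 : Space n))
      (r := 2 * (1 / 2) ^ j)).ne, ← ENNReal.ofReal_mul (mollifierBound_pos _).le]
    change ENNReal.ofReal (_ * volume.real _) = _
    rw [this, ENNReal.ofReal_pow (by norm_num)]
    norm_num
  · exact lintegral_enorm_indicator hΩ G

/-- The mollification error in `L¹` away from the boundary. -/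
lemma lintegral_edist_mollify_le (hΩ : IsOpen Ω) (hf : IntegrableOn f Ω)
    (hG : IntegrableOn G Ω) (h : HasWeakDeriv Ω f G) (j : ℕ) :
    ∫⁻ x in innerPart Ω j, edist (mollify j (Ω.indicator f) x) (f x)
      ≤ 4 * 8 ^ n * (1 / 2) ^ j * ∫⁻ x in Ω, ‖G x‖ₑ := by
  have h12 : ENNReal.ofReal (1 / 2) = 1 / 2 := by
    rw [ENNReal.ofReal_div_of_pos two_pos, ENNReal.ofReal_one, ENNReal.ofReal_ofNat]
  have hGm : AEMeasurable (fun t => ‖Ω.indicator G t‖ₑ) :=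
    aemeasurable_enorm_indicator hΩ.measurableSet hG
  -- The telescoping bound with `L = 0`: no Lebesgue points are involved, and each term has an
  -- integral controlled by the `L¹` norm of `G`.
  set d : ℕ → Space n → ℝ≥0∞ := fun i x =>
    2 * (1 / 2) ^ (i + j) * ENNReal.ofReal (oscBound Ω G (i + j) x 0) with hd
  have hdm : ∀ i, Measurable (d i) := by
    intro i
    have : Measurable fun x => ENNReal.ofReal (oscBound Ω G (i + j) x 0) := by
      simp_rw [ofReal_oscBound_zero hΩ.measurableSet hG]
      exact (measurable_lintegral_closedBall hGm _).const_mul _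
    exact this.const_mul _
  have h1 : ∫⁻ x in innerPart Ω j, edist (mollify j (Ω.indicator f) x) (f x)
      ≤ ∫⁻ x in innerPart Ω j, ∑' i, d i x := by
    refine lintegral_mono_ae ?_
    rw [ae_restrict_iff' (isOpen_innerPart j).measurableSet]
    filter_upwards [ae_tendsto_mollify (locallyIntegrable_indicator hΩ.measurableSet hf)]
      with x hx hxj
    rw [indicator_of_mem (innerPart_subset j hxj)] at hx
    have := edist_le_tsum_of_edist_le_of_tendsto₀
      (f := fun i => mollify (i + j) (Ω.indicator f) x) (fun i => d i x) (fun i => ?_)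
      ((tendsto_add_atTop_iff_nat j).2 hx)
    · simpa using this
    · have hle := dist_mollify_succ_le hΩ.measurableSet hf hG h
        (closedBall_subset_of_mem_innerPart (innerPart_mono (Nat.le_add_left j i) hxj)) 0
      rw [edist_dist, Nat.succ_eq_add_one, show i + 1 + j = i + j + 1 by ring]
      refine (ENNReal.ofReal_le_ofReal hle).trans (le_of_eq ?_)
      rw [hd, mul_right_comm, ENNReal.ofReal_mul (by positivity),
        ENNReal.ofReal_mul (by positivity), ENNReal.ofReal_pow (by positivity)]
      rw [h12, ENNReal.ofReal_ofNat]
  refine h1.trans ((setLIntegral_le_lintegral _ _).trans ?_)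
  rw [lintegral_tsum fun i => (hdm i).aemeasurable]
  simp_rw [hd]
  have h2 : ∀ i, ∫⁻ x, 2 * (1 / 2) ^ (i + j) * ENNReal.ofReal (oscBound Ω G (i + j) x 0)
      = (1 / 2) ^ i * (2 * (1 / 2) ^ j * (8 ^ n * ∫⁻ x in Ω, ‖G x‖ₑ)) := by
    intro i
    rw [lintegral_const_mul' _ _ (by simp [ENNReal.mul_eq_top, ENNReal.pow_eq_top_iff]),
      lintegral_ofReal_oscBound_zero hΩ.measurableSet hG, pow_add]
    ring
  simp_rw [h2]
  rw [ENNReal.tsum_mul_right]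
  simp_rw [one_div]
  rw [ENNReal.tsum_geometric_two]
  apply le_of_eq
  ring

/-- The value of a mollification at `x` is a pairing with a fixed kernel in `L^q`. -/
lemma WeakConv.tendsto_mollify {fk : ℕ → Space n → Space n} (hΩ : MeasurableSet Ω) (hp : 1 < p)
    (h : WeakConv Ω p fk f) (j : ℕ) (x : Space n) :
    Tendsto (fun k => mollify j (Ω.indicator (fk k)) x) atTop
      (𝓝 (mollify j (Ω.indicator f) x)) := by
  have e : ∀ g : Space n → Space n,
      mollify j (Ω.indicator g) x = ∫ t in Ω, mollifier n j (x - t) • g t := by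
    intro g
    rw [mollify_apply, ← integral_indicator hΩ]
    congr 1
    ext1 t
    by_cases ht : t ∈ Ω <;> simp [ht]
  simp_rw [e]
  refine h.tendsto _ (Real.HolderConjugate.conjExponent hp) (fun t => mollifier n j (x - t)) ?_
  exact (((mollifier_continuous j).comp (continuous_const.sub continuous_id)
    ).memLp_of_hasCompactSupport (mollifier_sub_hasCompactSupport j x)).restrict _

lemma measure_le_edist_mollify_le (hΩ : IsOpen Ω) (hf : IntegrableOn f Ω)
    (hG : IntegrableOn G Ω) (h : HasWeakDeriv Ω f G) (j : ℕ) {ε : ℝ≥0∞} (hε : ε ≠ 0)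
    (hε' : ε ≠ ⊤) :
    volume.restrict Ω {x | ε ≤ edist (mollify j (Ω.indicator f) x) (f x)} ≤
      volume (Ω \ innerPart Ω j) + 4 * 8 ^ n * (1 / 2) ^ j * (∫⁻ x in Ω, ‖G x‖ₑ) / ε := by
  have hm : AEStronglyMeasurable f (volume.restrict Ω) := hf.aestronglyMeasurable
  have hm2 : AEMeasurable (fun x => edist (mollify j (Ω.indicator f) x) (f x))
      (volume.restrict Ω) :=
    ((mollify_continuous j (locallyIntegrable_indicator hΩ.measurableSet
      hf)).aestronglyMeasurable.restrict).edist hm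
  have h1 : volume.restrict Ω {x | ε ≤ edist (mollify j (Ω.indicator f) x) (f x)} ≤
      volume (Ω \ innerPart Ω j) + volume.restrict (innerPart Ω j)
        {x | ε ≤ edist (mollify j (Ω.indicator f) x) (f x)} := by
    have : Ω = (Ω \ innerPart Ω j) ∪ innerPart Ω j :=
      (sdiff_union_of_subset (innerPart_subset j)).symm
    conv_lhs => rw [this]
    refine (Measure.restrict_union_le _ _ _).trans ?_
    rw [Measure.add_apply, ← this]
    refine add_le_add ((measure_mono (subset_univ _)).trans (by simp)) le_rfl
  refine h1.trans (add_le_add le_rfl ?_)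
  refine (meas_ge_le_lintegral_div (hm2.mono_measure
    (Measure.restrict_mono (innerPart_subset j) le_rfl)) hε hε').trans ?_
  gcongr
  exact lintegral_edist_mollify_le hΩ hf hG h j

/-- Weak convergence in `W^{1,p}` with bounded derivatives implies convergence in measure. -/
theorem WeakConv.tendstoInMeasure {fk : ℕ → Space n → Space n} (hΩ : IsOpen Ω)
    (hfin : volume Ω ≠ ⊤) (hp : 1 < p) (h : WeakConv Ω p fk f) {K : ℝ≥0∞} (hK : K ≠ ⊤)
    (hb : ∀ k, ∫⁻ x in Ω, ‖weakDeriv Ω (fk k) x‖ₑ ≤ K) :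
    TendstoInMeasure (volume.restrict Ω) fk atTop f := by
  have : IsFiniteMeasure (volume.restrict Ω) := ⟨by simpa using hfin.lt_top⟩
  have hint : ∀ {g}, MemSobolev Ω p g → IntegrableOn g Ω := fun hg => hg.integrableOn hp.le hfin
  have hintD : ∀ {g}, MemSobolev Ω p g → IntegrableOn (weakDeriv Ω g) Ω := fun hg =>
    hg.integrableOn_weakDeriv hΩ hp.le hfin
  have hloc : ∀ {g}, MemSobolev Ω p g → LocallyIntegrable (Ω.indicator g) := fun hg =>
    locallyIntegrable_indicator hΩ.measurableSet (hint hg)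
  -- Enlarged so that one mollification error bound `b j` serves the sequence and its limit alike.
  set K' : ℝ≥0∞ := max K (∫⁻ x in Ω, ‖weakDeriv Ω f x‖ₑ) with hK'
  have hK'top : K' ≠ ⊤ := (max_lt hK.lt_top (hintD h.mem_lim).2).ne
  refine tendstoInMeasure_of_ne_top fun ε hε hεtop => ?_
  have hε3 : ε / 3 ≠ 0 := by simp [hε.ne']
  have hε3' : ε / 3 ≠ ⊤ := (ENNReal.div_lt_top hεtop (by norm_num)).ne
  have hj := fun j => tendstoInMeasure_of_tendsto_ae (μ := volume.restrict Ω)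
    (fun k => (mollify_continuous j (hloc (h.mem k))).aestronglyMeasurable)
    (Eventually.of_forall fun x => h.tendsto_mollify hΩ.measurableSet hp j x)
  set b : ℕ → ℝ≥0∞ := fun j =>
    volume (Ω \ innerPart Ω j) + 4 * 8 ^ n * (1 / 2) ^ j * K' / (ε / 3) with hbdef
  have hbt : Tendsto b atTop (𝓝 0) := by
    have h1 : Tendsto (fun j : ℕ => ((1 / 2 : ℝ≥0∞)) ^ j) atTop (𝓝 0) :=
      ENNReal.tendsto_pow_atTop_nhds_zero_of_lt_one (by norm_num)
    have h2 := ENNReal.Tendsto.const_mul (a := 4 * 8 ^ n * K' / (ε / 3)) h1 (Or.inr ?_)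
    · rw [mul_zero] at h2
      have h3 := (tendsto_volume_sdiff_innerPart hΩ hfin).add h2
      rw [add_zero] at h3
      refine h3.congr fun j => ?_
      simp only [hbdef, div_eq_mul_inv]
      ring
    · refine (ENNReal.div_lt_top (ENNReal.mul_ne_top (ENNReal.mul_ne_top (by norm_num) ?_) hK'top)
        hε3).ne
      exact ENNReal.pow_ne_top (by norm_num)
  have hbound : ∀ {g}, MemSobolev Ω p g → ∫⁻ x in Ω, ‖weakDeriv Ω g x‖ₑ ≤ K' → ∀ j,
      volume.restrict Ω {x | ε / 3 ≤ edist (mollify j (Ω.indicator g) x) (g x)} ≤ b j := by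
    intro g hg hgK j
    refine (measure_le_edist_mollify_le hΩ (hint hg) (hintD hg) hg.hasWeakDeriv j hε3 hε3').trans ?_
    simp only [hbdef]
    gcongr
  rw [ENNReal.tendsto_nhds_zero]
  intro η hη
  have hη3 : 0 < η / 3 := ENNReal.div_pos hη.ne' (by norm_num)
  obtain ⟨j, hbj⟩ := (hbt.eventually (gt_mem_nhds hη3)).exists
  filter_upwards [(hj j (ε / 3) (pos_iff_ne_zero.2 hε3)).eventually (gt_mem_nhds hη3)] with k hk
  have hsub : {x | ε ≤ edist (fk k x) (f x)} ⊆
      {x | ε / 3 ≤ edist (mollify j (Ω.indicator (fk k)) x) (fk k x)} ∪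
      ({x | ε / 3 ≤ edist (mollify j (Ω.indicator (fk k)) x) (mollify j (Ω.indicator f) x)} ∪
      {x | ε / 3 ≤ edist (mollify j (Ω.indicator f) x) (f x)}) := by
    intro x hx
    by_contra hcon
    simp only [mem_union, mem_ofPred_eq, not_or, not_le] at hcon hx
    obtain ⟨h1, h2, h3⟩ := hcon
    rw [edist_comm] at h1
    have := edist_triangle4 (fk k x) (mollify j (Ω.indicator (fk k)) x)
      (mollify j (Ω.indicator f) x) (f x)
    have h4 := ENNReal.add_lt_add (ENNReal.add_lt_add h1 h2) h3
    rw [ENNReal.add_thirds] at h4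
    exact absurd (hx.trans this) (not_le.2 h4)
  rw [← ENNReal.add_thirds η, add_assoc]
  refine (measure_mono hsub).trans ((measure_union_le _ _).trans (add_le_add ?_
    ((measure_union_le _ _).trans (add_le_add hk.le ?_))))
  · exact (hbound (h.mem k) ((hb k).trans (le_max_left _ _)) j).trans hbj.le
  · exact (hbound h.mem_lim (le_max_right _ _) j).trans hbj.le

end Rellich

/-! ### Compactness of sets of bounded perimeter -/

section Perimeter

variable {n : ℕ} {A : Set (Space n)}

lemma divergence_smul_const {g : Space n → ℝ} (hg : Differentiable ℝ g) (h x : Space n) :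
    divergence (fun y => g y • h) x = fderiv ℝ g x h := by
  have h1 : fderiv ℝ (fun y => g y • h) x = (fderiv ℝ g x).smulRight h :=
    ((hg x).hasFDerivAt.smul_const h).fderiv
  have h2 : h = ∑ i, h i • EuclideanSpace.single i (1 : ℝ) := by
    ext j
    simp [Pi.single_apply]
  rw [divergence, h1]
  conv_rhs => rw [h2, map_sum]
  refine Finset.sum_congr rfl fun i _ => ?_
  simp [mul_comm]

lemma setIntegral_fderiv_le_perimeter (hP : perimeter A ≠ ⊤) {g : Space n → ℝ}
    (hg : ContDiff ℝ 1 g) (hc : HasCompactSupport g) (hb : ∀ x, ‖g x‖ ≤ 1) (h : Space n) :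
    ∫ x in A, fderiv ℝ g x h ≤ ‖h‖ * (perimeter A).toReal := by
  rcases eq_or_ne h 0 with rfl | hne
  · simp
  have hn : 0 < ‖h‖ := norm_pos_iff.2 hne
  have h1 : ENNReal.ofReal (∫ x in A, divergence (fun y => g y • (‖h‖⁻¹ • h)) x)
      ≤ perimeter A := by
    refine le_iSup₂_of_le (fun y => g y • (‖h‖⁻¹ • h)) (hg.smul contDiff_const) ?_
    refine le_iSup₂_of_le hc.smul_right (fun x => ?_) le_rfl
    rw [norm_smul, norm_smul, norm_inv, norm_norm, inv_mul_cancel₀ hn.ne', mul_one]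
    exact hb x
  rw [ENNReal.ofReal_le_iff_le_toReal hP] at h1
  simp_rw [divergence_smul_const (hg.differentiable (by simp)), map_smul, smul_eq_mul] at h1
  rw [integral_const_mul, inv_mul_le_iff₀ hn] at h1
  exact h1

/-- Along `t ↦ g (x - t h)` the integral over `A` has derivative `-∫_A ∂_h g`, which the perimeter
bounds from below; the mean value theorem on `[0, 1]` concludes. -/
lemma setIntegral_translate_ge (hA : volume A ≠ ⊤) (hP : perimeter A ≠ ⊤) {g : Space n → ℝ}
    (hg : ContDiff ℝ 1 g) (hc : HasCompactSupport g) (hb : ∀ x, ‖g x‖ ≤ 1) (h : Space n) :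
    (∫ x in A, g x) - ‖h‖ * (perimeter A).toReal ≤ ∫ x in A, g (x - h) := by
  have hfin : IsFiniteMeasure (volume.restrict A) := ⟨by simpa using hA.lt_top⟩
  have hgd : Differentiable ℝ g := hg.differentiable (by simp)
  have hDc : Continuous (fderiv ℝ g) := hg.continuous_fderiv (by simp)
  obtain ⟨M, hM⟩ := (hc.fderiv ℝ).exists_bound_of_continuous hDc
  have hsub : ∀ t : ℝ, Continuous fun x : Space n => x - t • h := fun t => by fun_prop
  have hgint : ∀ t : ℝ, Integrable (fun x => g (x - t • h)) (volume.restrict A) := fun t =>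
    Integrable.of_bound (hg.continuous.comp (hsub t)).aestronglyMeasurable 1
      (Eventually.of_forall fun x => hb _)
  have hderiv : ∀ t : ℝ, HasDerivAt (fun t : ℝ => ∫ x in A, g (x - t • h))
      (∫ x in A, - fderiv ℝ g (x - t • h) h) t := by
    intro t
    refine (hasDerivAt_integral_of_dominated_loc_of_deriv_le (μ := volume.restrict A)
      (F := fun t x => g (x - t • h)) (F' := fun t x => - fderiv ℝ g (x - t • h) h)
      (bound := fun _ => M * ‖h‖) univ_mem
      (Eventually.of_forall fun s => (hgint s).aestronglyMeasurable) (hgint t) ?_ ?_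
      (integrable_const _) ?_).2
    · exact (((hDc.comp (hsub t)).clm_apply continuous_const).neg).aestronglyMeasurable
    · refine Eventually.of_forall fun x s _ => ?_
      rw [norm_neg]
      exact ((fderiv ℝ g _).le_opNorm h).trans (by gcongr; exact hM _)
    · refine Eventually.of_forall fun x s _ => ?_
      have h1 : HasDerivAt (fun s : ℝ => x - s • h) (-h) s := by
        have := ((hasDerivAt_id s).smul_const h).const_sub x
        simpa using this
      have := (hgd (x - s • h)).hasFDerivAt.comp_hasDerivAt s h1
      rw [map_neg] at this
      exact this
  have hle : ∀ t : ℝ, - (‖h‖ * (perimeter A).toReal) ≤ ∫ x in A, - fderiv ℝ g (x - t • h) h := by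
    intro t
    rw [integral_neg, neg_le_neg_iff]
    have h1 : ∀ x, fderiv ℝ (fun y => g (y - t • h)) x = fderiv ℝ g (x - t • h) := fun x =>
      (by simpa [sub_eq_add_neg] using fderiv_comp_add_right (f := g) (x := x) (-(t • h)))
    have h2 := setIntegral_fderiv_le_perimeter hP (g := fun y => g (y - t • h))
      (hg.comp (contDiff_id.sub contDiff_const))
      (hc.comp_homeomorph (Homeomorph.subRight (t • h))) (fun x => hb _) h
    simp_rw [h1] at h2
    exact h2
  have key := mul_sub_le_image_sub_of_le_deriv (f := fun t : ℝ => ∫ x in A, g (x - t • h))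
    (fun t => (hderiv t).differentiableAt) (C := - (‖h‖ * (perimeter A).toReal))
    (fun t => by rw [(hderiv t).deriv]; exact hle t) zero_le_one
  simp only [sub_zero, mul_one, one_smul, zero_smul] at key
  linarith

lemma setIntegral_mollify_ge (hA : volume A ≠ ⊤) (hP : perimeter A ≠ ⊤) {g : Space n → ℝ}
    (hg : ContDiff ℝ 1 g) (hc : HasCompactSupport g) (hb : ∀ x, ‖g x‖ ≤ 1) (j : ℕ) :
    (∫ x in A, g x) - (1 / 2) ^ j * (perimeter A).toReal ≤ ∫ x in A, mollify j g x := by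
  have hfin : IsFiniteMeasure (volume.restrict A) := ⟨by simpa using hA.lt_top⟩
  have hmeas : AEStronglyMeasurable (fun q : Space n × Space n => mollifier n j q.2 * g (q.1 - q.2))
      ((volume.restrict A).prod volume) :=
    ((mollifier_continuous j).comp continuous_snd |>.mul
      (hg.continuous.comp (continuous_fst.sub continuous_snd))).aestronglyMeasurable
  have hint : Integrable (fun q : Space n × Space n => mollifier n j q.2 * g (q.1 - q.2))
      ((volume.restrict A).prod volume) := by
    refine Integrable.mono' ((integrable_const (1 : ℝ)).mul_prod (mollifier_integrable j)) hmeas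
      (Eventually.of_forall fun q => ?_)
    rw [norm_mul, Real.norm_of_nonneg (mollifier_nonneg _ _), one_mul]
    exact mul_le_of_le_one_right (mollifier_nonneg _ _) (hb _)
  have h1 : ∫ x in A, mollify j g x = ∫ t, mollifier n j t * ∫ x in A, g (x - t) := by
    have h2 := integral_integral_swap (μ := volume.restrict A) (ν := volume)
      (f := fun x t => mollifier n j t * g (x - t)) hint
    simp_rw [integral_const_mul] at h2
    exact h2
  have hint2 : Integrable fun t => mollifier n j t * ∫ x in A, g (x - t) := by
    have := hint.integral_prod_right
    simp_rw [integral_const_mul] at this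
    exact this
  set c := (∫ x in A, g x) - (1 / 2) ^ j * (perimeter A).toReal with hcdef
  have h3 : c = ∫ t, mollifier n j t * c := by
    rw [integral_mul_const, integral_mollifier, one_mul]
  rw [h1, h3]
  refine integral_mono ((mollifier_integrable j).mul_const c) hint2 fun t => ?_
  by_cases ht : t ∈ Function.support (mollifier n j)
  · rw [support_mollifier, Metric.mem_ball, dist_zero_right] at ht
    refine mul_le_mul_of_nonneg_left ?_ (mollifier_nonneg _ _)
    refine le_trans ?_ (setIntegral_translate_ge hA hP hg hc hb t)
    rw [hcdef]
    gcongr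
  · rw [Function.notMem_support] at ht
    simp [ht]

/-- The mollified indicator function of a set. -/
noncomputable def smoothIndicator (A : Set (Space n)) (j : ℕ) : Space n → ℝ :=
  mollify j (A.indicator 1)

lemma locallyIntegrable_indicator_one (hA : MeasurableSet A) (hAv : volume A ≠ ⊤) :
    LocallyIntegrable (A.indicator (1 : Space n → ℝ)) :=
  locallyIntegrable_indicator hA (integrableOn_const hAv (C := (1 : ℝ)))

lemma smoothIndicator_eq (hA : MeasurableSet A) (j : ℕ) (x : Space n) :
    smoothIndicator A j x = ∫ t in A, mollifier n j (x - t) := by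
  rw [smoothIndicator, mollify_apply, ← integral_indicator hA]
  congr 1
  ext1 t
  by_cases ht : t ∈ A <;> simp [ht]

lemma smoothIndicator_nonneg (hA : MeasurableSet A) (j : ℕ) (x : Space n) :
    0 ≤ smoothIndicator A j x := by
  rw [smoothIndicator_eq hA]
  exact integral_nonneg fun t => mollifier_nonneg _ _

lemma mollifier_sub_integrable (j : ℕ) (x : Space n) :
    Integrable fun t => mollifier n j (x - t) :=
  (mollifier_integrable j).comp_sub_left x

lemma smoothIndicator_le_one (hA : MeasurableSet A) (j : ℕ) (x : Space n) :
    smoothIndicator A j x ≤ 1 := by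
  rw [smoothIndicator_eq hA, ← integral_mollifier_sub j x]
  exact setIntegral_le_integral (mollifier_sub_integrable j x)
    (Eventually.of_forall fun t => mollifier_nonneg _ _)

lemma norm_smoothIndicator_le_one (hA : MeasurableSet A) (j : ℕ) (x : Space n) :
    ‖smoothIndicator A j x‖ ≤ 1 := by
  rw [Real.norm_of_nonneg (smoothIndicator_nonneg hA j x)]
  exact smoothIndicator_le_one hA j x

lemma norm_mollify_le_one {g : Space n → ℝ} (hb : ∀ x, ‖g x‖ ≤ 1) (j : ℕ) (x : Space n) :
    ‖mollify j g x‖ ≤ 1 := by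
  rw [mollify_apply, ← integral_mollifier_sub j x]
  refine norm_integral_le_of_norm_le (mollifier_sub_integrable j x)
    (Eventually.of_forall fun t => ?_)
  rw [norm_smul, Real.norm_of_nonneg (mollifier_nonneg _ _)]
  exact mul_le_of_le_one_right (mollifier_nonneg _ _) (hb t)

lemma smoothIndicator_eq_zero (hA : MeasurableSet A) {R : ℝ} (hAR : A ⊆ Metric.closedBall 0 R)
    (j : ℕ) {x : Space n} (hx : x ∉ Metric.closedBall 0 (R + 1)) : smoothIndicator A j x = 0 := by
  rw [smoothIndicator_eq hA]
  refine setIntegral_eq_zero_of_forall_eq_zero fun t ht => ?_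
  rw [← Function.notMem_support, support_mollifier, Metric.mem_ball, dist_zero_right,
    ← dist_eq_norm]
  intro h
  refine hx (Metric.mem_closedBall.2 ?_)
  have h1 := Metric.mem_closedBall.1 (hAR ht)
  have h2 := dist_triangle x t 0
  have h3 : ((1 : ℝ) / 2) ^ j ≤ 1 := pow_le_one₀ (by norm_num) (by norm_num)
  linarith

/-- The indicator of `A` would be the ideal test function in `setIntegral_mollify_ge`. It is
approximated by its mollifications at scale `m`, and `m → ∞` by dominated convergence. -/
lemma setIntegral_smoothIndicator_ge (hA : MeasurableSet A) {R : ℝ}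
    (hAR : A ⊆ Metric.closedBall 0 R) (hP : perimeter A ≠ ⊤) (j : ℕ) :
    volume.real A - (1 / 2) ^ j * (perimeter A).toReal ≤ ∫ x in A, smoothIndicator A j x := by
  have hAv : volume A ≠ ⊤ := ((measure_mono hAR).trans_lt measure_closedBall_lt_top).ne
  have hfin : IsFiniteMeasure (volume.restrict A) := ⟨by simpa using hAv.lt_top⟩
  have hloc := locallyIntegrable_indicator_one hA hAv
  have hsc : ∀ m, Continuous (smoothIndicator A m) := fun m => mollify_continuous m hloc
  have hm : ∀ m, (∫ x in A, smoothIndicator A m x) - (1 / 2) ^ j * (perimeter A).toReal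
      ≤ ∫ x in A, mollify m (smoothIndicator A j) x := by
    intro m
    rw [smoothIndicator, smoothIndicator, mollify_comm m j hloc]
    refine setIntegral_mollify_ge hAv hP ?_ ?_ (norm_smoothIndicator_le_one hA m) j
    · exact_mod_cast (mollifier_hasCompactSupport m).contDiff_convolution_left (n := 1)
        (ContinuousLinearMap.lsmul ℝ ℝ) ((mollifier_contDiff m).of_le (by norm_cast)) hloc
    · exact HasCompactSupport.intro (isCompact_closedBall 0 (R + 1)) fun x hx =>
        smoothIndicator_eq_zero hA hAR m hx
  have l1 : Tendsto (fun m => ∫ x in A, smoothIndicator A m x) atTop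
      (𝓝 (∫ x in A, A.indicator (1 : Space n → ℝ) x)) := by
    refine tendsto_integral_of_dominated_convergence (fun _ => 1)
      (fun m => (hsc m).aestronglyMeasurable) (integrable_const _)
      (fun m => Eventually.of_forall fun x => norm_smoothIndicator_le_one hA m x)
      (ae_restrict_of_ae (ae_tendsto_mollify hloc))
  have l2 : Tendsto (fun m => ∫ x in A, mollify m (smoothIndicator A j) x) atTop
      (𝓝 (∫ x in A, smoothIndicator A j x)) := by
    refine tendsto_integral_of_dominated_convergence (fun _ => 1)
      (fun m => (mollify_continuous m (hsc j).locallyIntegrable).aestronglyMeasurable)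
      (integrable_const _)
      (fun m => Eventually.of_forall fun x =>
        norm_mollify_le_one (norm_smoothIndicator_le_one hA j) m x)
      (ae_restrict_of_ae (ae_tendsto_mollify (hsc j).locallyIntegrable))
  have e1 : ∫ x in A, A.indicator (1 : Space n → ℝ) x = volume.real A := by
    rw [setIntegral_indicator hA, inter_self]
    simp
  rw [e1] at l1
  exact le_of_tendsto_of_tendsto' (l1.sub_const _) l2 hm

/-- The smoothed indicator takes values in `[0, 1]` and has integral `|A|`, so the `L¹` error equals
`2 (|A| - ∫_A smoothIndicator A j)`. -/
lemma integral_norm_smoothIndicator_sub_le (hA : MeasurableSet A) {R : ℝ}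
    (hAR : A ⊆ Metric.closedBall 0 R) (hP : perimeter A ≠ ⊤) (j : ℕ) :
    ∫ x, ‖smoothIndicator A j x - A.indicator 1 x‖ ≤ 2 * (1 / 2) ^ j * (perimeter A).toReal := by
  have hAv : volume A ≠ ⊤ := ((measure_mono hAR).trans_lt measure_closedBall_lt_top).ne
  have hi1 : Integrable (A.indicator (1 : Space n → ℝ)) :=
    (integrableOn_const hAv (C := (1 : ℝ))).integrable_indicator hA
  have hi2 : Integrable (smoothIndicator A j) :=
    (mollifier_integrable j).integrable_convolution _ hi1
  have e1 : ∫ x, A.indicator (1 : Space n → ℝ) x = volume.real A := by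
    rw [integral_indicator hA]; simp
  have e2 : ∫ x, smoothIndicator A j x = volume.real A := by
    rw [smoothIndicator, mollify, integral_convolution _ (mollifier_integrable j) hi1,
      integral_mollifier, e1]
    simp
  have hpt : ∀ x, ‖smoothIndicator A j x - A.indicator 1 x‖ = smoothIndicator A j x
      + A.indicator 1 x - 2 * A.indicator (smoothIndicator A j) x := by
    intro x
    have h0 := smoothIndicator_nonneg hA j x
    have h1 := smoothIndicator_le_one hA j x
    by_cases hx : x ∈ A
    · simp only [indicator_of_mem hx, Pi.one_apply, Real.norm_eq_abs]
      rw [abs_of_nonpos (by linarith)]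
      ring
    · simp [indicator_of_notMem hx, h0]
  simp_rw [hpt]
  have hi3 : Integrable fun x => smoothIndicator A j x + A.indicator 1 x := hi2.add hi1
  rw [integral_sub hi3 ((hi2.indicator hA).const_mul 2), integral_add hi2 hi1, e1, e2,
    integral_const_mul, integral_indicator hA]
  have := setIntegral_smoothIndicator_ge hA hAR hP j
  linarith

end Perimeter

section SetCompactness

variable {n : ℕ}

/-- The indicators are bounded in the separable Hilbert space `L²`; sequential Banach–Alaoglu gives
weak convergence along a subsequence. -/
lemma exists_subseq_forall_tendsto_setIntegral {A : ℕ → Set (Space n)}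
    (hA : ∀ k, MeasurableSet (A k)) {R : ℝ} (hAR : ∀ k, A k ⊆ Metric.closedBall 0 R) :
    ∃ σ : ℕ → ℕ, StrictMono σ ∧ ∀ g : Space n → ℝ, MemLp g 2 →
      ∃ l, Tendsto (fun k => ∫ x in A (σ k), g x) atTop (𝓝 l) := by
  have : Fact ((2 : ℝ≥0∞) ≠ ⊤) := ⟨by norm_num⟩
  have hfin : ∀ k, volume (A k) ≠ ⊤ := fun k =>
    ((measure_mono (hAR k)).trans_lt measure_closedBall_lt_top).ne
  set e : ℕ → Lp ℝ 2 (volume : Measure (Space n)) := fun k =>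
    indicatorConstLp 2 (hA k) (hfin k) (1 : ℝ) with he
  set r : ℝ := volume.real (Metric.closedBall (0 : Space n) R) ^ (1 / (2 : ℝ≥0∞).toReal) with hr
  have hbound : ∀ k, ‖e k‖ ≤ r := by
    intro k
    refine norm_indicatorConstLp_le.trans ?_
    rw [norm_one, one_mul, hr]
    exact Real.rpow_le_rpow measureReal_nonneg
      (measureReal_mono (hAR k) measure_closedBall_lt_top.ne) (by positivity)
  set T : ℕ → WeakDual ℝ (Lp ℝ 2 (volume : Measure (Space n))) := fun k =>
    StrongDual.toWeakDual (innerSL ℝ (e k)) with hT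
  have hTmem : ∀ k, T k ∈ WeakDual.toStrongDual ⁻¹' Metric.closedBall 0 r := by
    intro k
    simp only [mem_preimage, mem_closedBall_zero_iff]
    change ‖innerSL ℝ (e k)‖ ≤ r
    rw [innerSL_apply_norm]
    exact hbound k
  obtain ⟨T', -, σ, hσ, hlim⟩ := WeakDual.isSeqCompact_closedBall ℝ
    (Lp ℝ 2 (volume : Measure (Space n))) 0 r hTmem
  refine ⟨σ, hσ, fun g hg => ⟨T' (hg.toLp g), ?_⟩⟩
  have h1 := ((WeakDual.eval_continuous (hg.toLp g)).tendsto T').comp hlim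
  refine h1.congr fun k => ?_
  change inner ℝ (e (σ k)) (hg.toLp g) = _
  rw [he, L2.inner_indicatorConstLp_one]
  exact integral_congr_ae (ae_restrict_of_ae hg.coeFn_toLp)

lemma volume_real_symmDiff_eq {A B : Set (Space n)} (hA : MeasurableSet A) (hB : MeasurableSet B) :
    volume.real (A ∆ B) = ∫ x, ‖A.indicator (1 : Space n → ℝ) x - B.indicator 1 x‖ := by
  have h : (fun x => ‖A.indicator (1 : Space n → ℝ) x - B.indicator 1 x‖)
      = (A ∆ B).indicator 1 := by
    ext x
    by_cases hxA : x ∈ A <;> by_cases hxB : x ∈ B <;>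
      simp [hxA, hxB, mem_symmDiff]
  rw [h, integral_indicator_one (hA.symmDiff hB)]

lemma integral_norm_sub_le_add {f g h : Space n → ℝ} (hf : Integrable f) (hg : Integrable g)
    (hh : Integrable h) :
    ∫ x, ‖f x - h x‖ ≤ (∫ x, ‖g x - f x‖) + ∫ x, ‖g x - h x‖ := by
  have h1 : Integrable fun x => ‖g x - f x‖ := (hg.sub hf).norm
  have h2 : Integrable fun x => ‖g x - h x‖ := (hg.sub hh).norm
  rw [← integral_add h1 h2]
  refine integral_mono (hf.sub hh).norm (h1.add h2) fun x => ?_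
  rw [norm_sub_rev (g x) (f x)]
  exact norm_sub_le_norm_sub_add_norm_sub _ _ _

lemma memLp_mollifier_sub (j : ℕ) (x : Space n) (q : ℝ≥0∞) :
    MemLp (fun t => mollifier n j (x - t)) q :=
  ((mollifier_continuous j).comp (continuous_const.sub continuous_id)
    ).memLp_of_hasCompactSupport (mollifier_sub_hasCompactSupport j x)

/-- A bounded sequence of sets of bounded perimeter has a subsequence that converges in measure. -/
theorem exists_subseq_tendstoInMeas {A : ℕ → Set (Space n)}
    (hA : ∀ k, MeasurableSet (A k)) {R : ℝ} (hAR : ∀ k, A k ⊆ Metric.closedBall 0 R)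
    {P : ℝ≥0∞} (hPtop : P ≠ ⊤) (hP : ∀ k, perimeter (A k) ≤ P) :
    ∃ σ : ℕ → ℕ, StrictMono σ ∧ ∃ B, NullMeasurableSet B volume ∧
      TendstoInMeas (fun k => A (σ k)) B := by
  obtain ⟨σ, hσ, hw⟩ := exists_subseq_forall_tendsto_setIntegral hA hAR
  have hfin : ∀ k, volume (A k) ≠ ⊤ := fun k =>
    ((measure_mono (hAR k)).trans_lt measure_closedBall_lt_top).ne
  have hsm : ∀ k j, AEStronglyMeasurable (smoothIndicator (A k) j) volume := fun k j =>
    (mollify_continuous j (locallyIntegrable_indicator_one (hA k) (hfin k))).aestronglyMeasurable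
  have hi1 : ∀ k, Integrable ((A k).indicator (1 : Space n → ℝ)) := fun k =>
    (integrableOn_const (hfin k) (C := (1 : ℝ))).integrable_indicator (hA k)
  have hi2 : ∀ k j, Integrable (smoothIndicator (A k) j) := fun k j =>
    (mollifier_integrable j).integrable_convolution _ (hi1 k)
  -- At a fixed scale, weak convergence becomes pointwise convergence, hence `L¹` convergence. The
  -- perimeter bounds the smoothing error uniformly in `k`, so the indicators are Cauchy in `L¹`.
  have hpt : ∀ j x, ∃ l, Tendsto (fun k => smoothIndicator (A (σ k)) j x) atTop (𝓝 l) := by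
    intro j x
    obtain ⟨l, hl⟩ := hw _ (memLp_mollifier_sub j x 2)
    exact ⟨l, hl.congr fun k => (smoothIndicator_eq (hA _) j x).symm⟩
  choose θ hθ using hpt
  have hθ0 : ∀ j x, x ∉ Metric.closedBall (0 : Space n) (R + 1) → θ j x = 0 := by
    intro j x hx
    refine tendsto_nhds_unique (hθ j x) ?_
    simp_rw [smoothIndicator_eq_zero (hA _) (hAR _) j hx]
    exact tendsto_const_nhds
  have hθ1 : ∀ j x, ‖θ j x‖ ≤ 1 := fun j x =>
    le_of_tendsto' (hθ j x).norm fun k => norm_smoothIndicator_le_one (hA _) j x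
  have hθm : ∀ j, AEStronglyMeasurable (θ j) volume := fun j =>
    aestronglyMeasurable_of_tendsto_ae atTop (fun k => hsm (σ k) j)
      (Eventually.of_forall fun x => hθ j x)
  have hbi : Integrable ((Metric.closedBall (0 : Space n) (R + 1)).indicator fun _ => (1 : ℝ)) :=
    (integrableOn_const measure_closedBall_lt_top.ne).integrable_indicator
      Metric.isClosed_closedBall.measurableSet
  have hθi : ∀ j, Integrable (θ j) := by
    intro j
    refine hbi.mono' (hθm j) (Eventually.of_forall fun x => ?_)
    by_cases hx : x ∈ Metric.closedBall (0 : Space n) (R + 1)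
    · rw [indicator_of_mem hx]; exact hθ1 j x
    · rw [indicator_of_notMem hx, hθ0 j x hx, norm_zero]
  have hL1 : ∀ j, Tendsto (fun k => ∫ x, ‖smoothIndicator (A (σ k)) j x - θ j x‖) atTop (𝓝 0) := by
    intro j
    have h0 : ∫ x : Space n, (0 : ℝ) = 0 := integral_zero _ _
    rw [← h0]
    refine tendsto_integral_of_dominated_convergence
      ((Metric.closedBall (0 : Space n) (R + 1)).indicator fun _ => (2 : ℝ))
      (fun k => ((hsm (σ k) j).sub (hθm j)).norm) ?_ (fun k => Eventually.of_forall fun x => ?_)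
      (Eventually.of_forall fun x => ?_)
    · exact (integrableOn_const measure_closedBall_lt_top.ne).integrable_indicator
        Metric.isClosed_closedBall.measurableSet
    · rw [norm_norm]
      by_cases hx : x ∈ Metric.closedBall (0 : Space n) (R + 1)
      · rw [indicator_of_mem hx]
        refine (norm_sub_le _ _).trans ?_
        linarith [norm_smoothIndicator_le_one (hA (σ k)) j x, hθ1 j x]
      · rw [indicator_of_notMem hx, hθ0 j x hx, smoothIndicator_eq_zero (hA _) (hAR _) j hx]
        simp
    · have := ((hθ j x).sub_const (θ j x)).norm
      simpa using this
  have herr : ∀ k j, ∫ x, ‖smoothIndicator (A k) j x - (A k).indicator 1 x‖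
      ≤ 2 * (1 / 2) ^ j * P.toReal := by
    intro k j
    refine (integral_norm_smoothIndicator_sub_le (hA k) (hAR k)
      ((hP k).trans_lt hPtop.lt_top).ne j).trans ?_
    gcongr
    exact hP k
  have htri : ∀ k j, ∫ x, ‖(A (σ k)).indicator 1 x - θ j x‖ ≤ 2 * (1 / 2) ^ j * P.toReal
      + ∫ x, ‖smoothIndicator (A (σ k)) j x - θ j x‖ := by
    intro k j
    exact (integral_norm_sub_le_add (hi1 _) (hi2 _ j) (hθi j)).trans
      (add_le_add (herr (σ k) j) le_rfl)
  have hdiff : ∀ k l j, volume.real (A (σ k) ∆ A (σ l)) ≤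
      (∫ x, ‖(A (σ k)).indicator 1 x - θ j x‖) + ∫ x, ‖(A (σ l)).indicator 1 x - θ j x‖ := by
    intro k l j
    rw [volume_real_symmDiff_eq (hA _) (hA _)]
    refine (integral_norm_sub_le_add (hi1 _) (hθi j) (hi1 _)).trans (le_of_eq ?_)
    simp_rw [norm_sub_rev (θ j _)]
  set E : ℕ → Lp ℝ 1 (volume : Measure (Space n)) := fun k =>
    indicatorConstLp 1 (hA (σ k)) (hfin (σ k)) (1 : ℝ) with hE
  have hcauchy : CauchySeq E := by
    rw [Metric.cauchySeq_iff]
    intro ε hε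
    have hpow : Tendsto (fun j : ℕ => 2 * (1 / 2) ^ j * P.toReal) atTop (𝓝 0) := by
      have := ((tendsto_pow_atTop_nhds_zero_of_lt_one (r := (1 / 2 : ℝ)) (by norm_num)
        (by norm_num)).const_mul 2).mul_const P.toReal
      simpa using this
    obtain ⟨j, hj⟩ := (hpow.eventually (gt_mem_nhds (show 0 < ε / 4 by positivity))).exists
    obtain ⟨N, hN⟩ := eventually_atTop.1
      ((hL1 j).eventually (gt_mem_nhds (show 0 < ε / 4 by positivity)))
    refine ⟨N, fun k hk l hl => ?_⟩
    have hd : dist (E k) (E l) = volume.real (A (σ k) ∆ A (σ l)) := by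
      rw [hE, dist_indicatorConstLp_eq_norm, norm_indicatorConstLp one_ne_zero (by norm_num)]
      simp
    rw [hd]
    have := hdiff k l j
    linarith [htri k j, htri l j, hN k hk, hN l hl]
  obtain ⟨g, hg⟩ := cauchySeq_tendsto_of_complete hcauchy
  -- Where an indicator disagrees with this superlevel set, it differs from `g` by at least `1 / 2`,
  -- so convergence in measure to `g` suffices.
  refine ⟨σ, hσ, {x | 1 / 2 < g x}, ?_, ?_⟩
  · exact nullMeasurableSet_lt aemeasurable_const (Lp.aestronglyMeasurable g).aemeasurable
  · have hm := tendstoInMeasure_of_tendsto_Lp hg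
    have h2 := hm (1 / 2) (by norm_num)
    refine tendsto_of_tendsto_of_tendsto_of_le_of_le tendsto_const_nhds h2 (fun _ => bot_le)
      fun k => measure_mono_ae ?_
    have hcoe : E k =ᵐ[volume] (A (σ k)).indicator fun _ => (1 : ℝ) := indicatorConstLp_coeFn
    filter_upwards [hcoe] with x hx hmem
    change 1 / 2 ≤ edist (E k x) (g x)
    have h12 : (1 / 2 : ℝ≥0∞) = ENNReal.ofReal (1 / 2) := by
      rw [ENNReal.ofReal_div_of_pos two_pos, ENNReal.ofReal_one, ENNReal.ofReal_ofNat]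
    rw [h12, edist_dist, hx, Real.dist_eq]
    refine ENNReal.ofReal_le_ofReal ?_
    rcases hmem with ⟨h3, h4⟩ | ⟨h3, h4⟩
    · rw [indicator_of_mem h3]
      have h5 : g x ≤ 1 / 2 := not_lt.1 h4
      exact le_trans (by linarith) (le_abs_self _)
    · rw [indicator_of_notMem h4]
      have h5 : 1 / 2 < g x := h3
      exact le_trans (by linarith) (neg_le_abs _)

end SetCompactness

/-! ### Limits of homeomorphisms with finitely many cavities -/

section Approximation

variable {n : ℕ} {Ω : Set (Space n)} {p : ℝ} {φ : ℝ → ℝ} {a C : ℝ} {f₀ f : Space n → Space n}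
  {fk : ℕ → Space n → Space n} {Ak : ℕ → Set (Space n)} {A : Set (Space n)}

lemma HasCavitySet.isClosed (h : HasCavitySet Ω p f₀ f A) : IsClosed A := by
  obtain ⟨m, x, K, -, hK, -, -, -, rfl⟩ := h.exists_cavities
  exact isClosed_iUnion_of_finite fun i => (hK i).2.2.1.isClosed

lemma HasCavitySet.subset (h : HasCavitySet Ω p f₀ f A) : A ⊆ closure (f₀ '' Ω) := by
  obtain ⟨m, x, K, -, hK, -, -, -, rfl⟩ := h.exists_cavities
  exact iUnion_subset fun i => (hK i).1.trans subset_closure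

lemma isCompact_closure_image (hbdd : Bornology.IsBounded Ω)
    (hf₀ : IsEmbedding ((closure Ω).domRestrict f₀)) : IsCompact (closure (f₀ '' Ω)) := by
  have h1 : IsCompact (f₀ '' closure Ω) := hbdd.isCompact_closure.image_of_continuousOn
    (continuousOn_iff_continuous_domRestrict.2 hf₀.continuous)
  exact h1.closure_of_subset (image_mono subset_closure)

lemma energy_le_cavityEnergy : energy Ω p φ f ≤ cavityEnergy Ω p φ a f A := le_self_add

lemma lintegral_extend_det_le_energy :
    ∫⁻ x in Ω, extend φ (weakDeriv Ω f x).det ≤ energy Ω p φ f :=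
  lintegral_mono fun _ => le_add_self

lemma lintegral_enorm_weakDeriv_le (hp : 1 ≤ p) :
    ∫⁻ x in Ω, ‖weakDeriv Ω f x‖ₑ ≤ volume Ω + energy Ω p φ f := by
  have h1 : ∀ x, ‖weakDeriv Ω f x‖ₑ
      ≤ 1 + (‖weakDeriv Ω f x‖ₑ ^ p + extend φ (weakDeriv Ω f x).det) := by
    intro x
    rcases le_total ‖weakDeriv Ω f x‖ₑ 1 with h | h
    · exact h.trans le_self_add
    · refine le_add_left (le_add_right ?_)
      conv_lhs => rw [← ENNReal.rpow_one ‖weakDeriv Ω f x‖ₑ]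
      exact ENNReal.rpow_le_rpow_of_exponent_le h hp
  refine (lintegral_mono h1).trans (le_of_eq ?_)
  rw [lintegral_add_left measurable_const, setLIntegral_const, one_mul, energy]

lemma perimeter_le_of_cavityEnergy_le (ha : 0 < a)
    (h : cavityEnergy Ω p φ a f A ≤ ENNReal.ofReal C) :
    perimeter A ≤ ENNReal.ofReal C / ENNReal.ofReal a := by
  rw [ENNReal.le_div_iff_mul_le (Or.inl (by simpa using ha)) (Or.inl ENNReal.ofReal_ne_top),
    mul_comm]
  exact le_add_self.trans h

variable [Nontrivial (Space n)]

lemma IsApproximation.transportLimit (hp : 1 < p) (hφ : GrowthAssumptions φ) (hΩ : IsOpen Ω)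
    (hfin : volume Ω ≠ ⊤) (hbd : volume (f₀ '' frontier Ω) = 0)
    (h : IsApproximation Ω p φ a f₀ C fk Ak f) (σ : ℕ → ℕ)
    (hlim : ∀ᵐ x ∂(volume.restrict Ω), Tendsto (fun k => fk (σ k) x) atTop (𝓝 (f x)))
    {B : Set (Space n)} (hB : TendstoInMeas (fun k => Ak (σ k)) B) :
    TransportLimit (volume.restrict Ω) φ (ENNReal.ofReal C) (closure (f₀ '' Ω))
      (fun k => fk (σ k)) (fun k x => (weakDeriv Ω (fk (σ k)) x).det) (fun k => Ak (σ k)) f B := by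
  have hm : ∀ k, AEMeasurable (fk k) (volume.restrict Ω) := fun k =>
    (h.hasCavitySet k).aemeasurable hΩ hbd
  have hdet : ∀ k, AEMeasurable (fun x => (weakDeriv Ω (fk k) x).det) (volume.restrict Ω) :=
    fun k => (ContinuousLinearMap.continuous_det.comp_aestronglyMeasurable
      ((h.hasCavitySet k).mem_sobolev.integrableOn_weakDeriv hΩ hp.le
        hfin).aestronglyMeasurable).aemeasurable
  have hE : ∀ k, ∫⁻ x in Ω, extend φ (weakDeriv Ω (fk k) x).det ≤ ENNReal.ofReal C := fun k =>
    lintegral_extend_det_le_energy.trans (energy_le_cavityEnergy.trans (h.energy_le k))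
  refine ⟨fun k => hm _, fun k => hdet _, fun k => hE _, fun k S hS => ?_,
    fun k => (h.hasCavitySet _).subset, hlim, hB⟩
  rw [← (h.hasCavitySet (σ k)).lintegral_abs_det_eq hp.le hΩ hfin hbd hS,
    Measure.restrict_restrict₀ ((hm _).nullMeasurableSet_preimage hS), inter_comm]
  -- The area formula involves `|det|`; finite energy removes the absolute value.
  have hpos := ae_pos_of_lintegral_extend_le hφ ENNReal.ofReal_ne_top (hdet (σ k)) (hE (σ k))
  refine lintegral_congr_ae ?_
  filter_upwards [ae_mono (Measure.restrict_mono_set volume inter_subset_left) hpos] with x hx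
  rw [abs_of_pos hx]

/-- Two extractions, first for a.e. convergence of the maps and then for convergence of the cavity
sets. Starting from an arbitrary `σ` prepares the subsequence principle. -/
lemma IsApproximation.exists_transportLimit (hp : 1 < p) (hφ : GrowthAssumptions φ) (ha : 0 < a)
    (hΩ : IsOpen Ω) (hbdd : Bornology.IsBounded Ω)
    (hf₀ : IsEmbedding ((closure Ω).domRestrict f₀)) (hbd : volume (f₀ '' frontier Ω) = 0)
    (h : IsApproximation Ω p φ a f₀ C fk Ak f) (σ : ℕ → ℕ) (hσ : Tendsto σ atTop atTop) :
    ∃ (τ : ℕ → ℕ) (B : Set (Space n)), NullMeasurableSet B volume ∧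
      TransportLimit (volume.restrict Ω) φ (ENNReal.ofReal C) (closure (f₀ '' Ω))
        (fun k => fk (σ (τ k))) (fun k x => (weakDeriv Ω (fk (σ (τ k))) x).det)
        (fun k => Ak (σ (τ k))) f B := by
  have hfin : volume Ω ≠ ⊤ := hbdd.measure_lt_top.ne
  obtain ⟨R, hR⟩ := (isCompact_closure_image hbdd hf₀).isBounded.subset_closedBall 0
  have hmeas : TendstoInMeasure (volume.restrict Ω) (fun k => fk (σ k)) atTop f := by
    have h1 := h.weakConv.tendstoInMeasure hΩ hfin hp
      (K := volume Ω + ENNReal.ofReal C) (by simp [hfin]) fun k =>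
        (lintegral_enorm_weakDeriv_le (φ := φ) hp.le).trans
          (add_le_add le_rfl (energy_le_cavityEnergy.trans (h.energy_le k)))
    exact fun ε hε => (h1 ε hε).comp hσ
  obtain ⟨τ, hτ, hlim⟩ := hmeas.exists_seq_tendsto_ae
  obtain ⟨ρ, hρ, B, hBm, hB⟩ := exists_subseq_tendstoInMeas
    (A := fun k => Ak (σ (τ k))) (R := R) (P := ENNReal.ofReal C / ENNReal.ofReal a)
    (fun k => (h.hasCavitySet _).isClosed.measurableSet)
    (fun k => (h.hasCavitySet _).subset.trans hR)
    (ENNReal.div_lt_top ENNReal.ofReal_ne_top (by simpa using ha)).ne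
    (fun k => perimeter_le_of_cavityEnergy_le ha (h.energy_le _))
  refine ⟨fun k => τ (ρ k), B, hBm, h.transportLimit hp hφ hΩ hfin hbd _ ?_ hB⟩
  exact hlim.mono fun x hx => hx.comp hρ.tendsto_atTop

end Approximation

end Cavitation

/-- Any two subsequential limits in measure of the cavity sets `A(f_k)` of a weakly and a.e.
convergent sequence with bounded energy agree up to a null set; hence every weak limit map `f` has a
cavity set `A(f)`, unique up to a null set. -/
theorem theorem4p2 {n : ℕ} (hn : 2 ≤ n) {p : ℝ} (hp : ((n / 2 : ℕ) : ℝ) < p)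
    {φ : ℝ → ℝ} (hφ : GrowthAssumptions φ) {a : ℝ} (ha : 0 < a)
    {Ω : Set (Space n)} (hΩ_open : IsOpen Ω) (hΩ_conn : IsConnected Ω)
    (hΩ_bdd : Bornology.IsBounded Ω)
    {f₀ : Space n → Space n} (hf₀ : IsEmbedding ((closure Ω).domRestrict f₀))
    (hf₀_sob : MemSobolev Ω p f₀) (hf₀_lusin : LusinN Ω f₀)
    (hf₀_energy : energy Ω p φ f₀ < ⊤) (hf₀_bdry : volume (f₀ '' frontier Ω) = 0) (C : ℝ) :
    (∀ (f : Space n → Space n) (fk : ℕ → Space n → Space n) (Ak : ℕ → Set (Space n)),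
      IsApproximation Ω p φ a f₀ C fk Ak f →
      (∀ᵐ x ∂(volume.restrict Ω), Tendsto (fun k => fk k x) atTop (𝓝 (f x))) →
      ∀ σ τ : ℕ → ℕ, StrictMono σ → StrictMono τ →
      ∀ A₁ A₂ : Set (Space n), NullMeasurableSet A₁ volume → NullMeasurableSet A₂ volume →
        TendstoInMeas (fun l => Ak (σ l)) A₁ → TendstoInMeas (fun m => Ak (τ m)) A₂ →
        volume (A₁ ∆ A₂) = 0) ∧
    (∀ f ∈ weakClosure Ω p φ a f₀ C,
      (∃ A, IsLimitCavitySet Ω p φ a f₀ C f A) ∧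
      ∀ A A', IsLimitCavitySet Ω p φ a f₀ C f A → IsLimitCavitySet Ω p φ a f₀ C f A' →
        volume (A ∆ A') = 0) := by
  have hnonempty : Nonempty (Fin n) := ⟨⟨0, by omega⟩⟩
  have hnontriv : Nontrivial (Space n) := inferInstance
  have hp1 : 1 < p := by
    have h1 : 1 ≤ n / 2 := by omega
    have h2 : (1 : ℝ) ≤ ((n / 2 : ℕ) : ℝ) := by exact_mod_cast h1
    linarith
  have hfin : volume Ω ≠ ⊤ := hΩ_bdd.measure_lt_top.ne
  have hΩfin : IsFiniteMeasure (volume.restrict Ω) := ⟨by simpa using hfin.lt_top⟩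
  have hDc : IsCompact (closure (f₀ '' Ω)) := isCompact_closure_image hΩ_bdd hf₀
  have hD : volume (closure (f₀ '' Ω)) ≠ ⊤ := hDc.measure_lt_top.ne
  have hDm : NullMeasurableSet (closure (f₀ '' Ω)) volume :=
    isClosed_closure.measurableSet.nullMeasurableSet
  have key : ∀ {f : Space n → Space n} {u u' : ℕ → Space n → Space n}
      {J J' : ℕ → Space n → ℝ} {A A' : ℕ → Set (Space n)} {B B' : Set (Space n)},
      TransportLimit (volume.restrict Ω) φ (ENNReal.ofReal C) (closure (f₀ '' Ω)) u J A f B →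
      TransportLimit (volume.restrict Ω) φ (ENNReal.ofReal C) (closure (f₀ '' Ω)) u' J' A' f B' →
      NullMeasurableSet B volume → NullMeasurableSet B' volume → volume (B ∆ B') = 0 :=
    fun h h' hB hB' => measure_union_null
      (h'.volume_sdiff_eq_zero hφ ENNReal.ofReal_ne_top hD hDm h hB)
      (h.volume_sdiff_eq_zero hφ ENNReal.ofReal_ne_top hD hDm h' hB')
  constructor
  · intro f fk Ak h hlim σ τ hσ hτ A₁ A₂ hA₁ hA₂ h₁ h₂
    exact key
      (h.transportLimit hp1 hφ hΩ_open hfin hf₀_bdry σ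
        (hlim.mono fun x hx => hx.comp hσ.tendsto_atTop) h₁)
      (h.transportLimit hp1 hφ hΩ_open hfin hf₀_bdry τ
        (hlim.mono fun x hx => hx.comp hτ.tendsto_atTop) h₂) hA₁ hA₂
  · rintro f ⟨fk, Ak, h⟩
    constructor
    · obtain ⟨τ, B, hBm, hT⟩ :=
        h.exists_transportLimit hp1 hφ ha hΩ_open hΩ_bdd hf₀ hf₀_bdry id tendsto_id
      -- `B` comes from one approximating sequence. Any subsequence of any other has a further
      -- subsequence whose cavity sets converge to some `B'`, and `key` identifies `B'` with `B`.
      refine ⟨B, hBm, fun gk Dk hg => tendsto_of_subseq_tendsto fun σ hσ => ?_⟩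
      obtain ⟨τ', B', hBm', hT'⟩ :=
        hg.exists_transportLimit hp1 hφ ha hΩ_open hΩ_bdd hf₀ hf₀_bdry σ hσ
      refine ⟨τ', tendsto_of_tendsto_of_tendsto_of_le_of_le tendsto_const_nhds hT'.tendsto_sets
        (fun _ => bot_le) fun k => ?_⟩
      refine (measure_symmDiff_le _ B' _).trans ?_
      rw [key hT' hT hBm' hBm, add_zero]
    · intro A A' hA hA'
      have h1 := (hA.2 fk Ak h).add (hA'.2 fk Ak h)
      rw [add_zero] at h1
      refine le_antisymm (ge_of_tendsto' h1 fun k => ?_) bot_le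
      refine (measure_symmDiff_le _ (Ak k) _).trans ?_
      rw [symmDiff_comm A]
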